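/- Let $\mathbf k$ be a field of characteristic zero. **Bracketings.** For $n\ge 1$ let $\mathrm{Br}_n$ be the set of full bracketings of $n$ symbols; for $n\ge 2$ these are the vertices of the Stasheff associahedron $K_n$. For $u\in \mathrm{Br}_a$, $v\in\mathrm{Br}_b$ and $1\le t\le b$ let $\iota_t(u,v)=(u,v)_t\in \mathrm{Br}_{a+b-1}$ be obtained by inserting $(u)$ at the $t$-th place of $v$. Let $\prec$ be the partial order on $\mathrm{Br}_n$ generated by the substitutions $(w_1w_2)w_3\mapsto w_1(w_2w_3)$ inside a bracketing (the result being the larger element), and let $\xi_n=(\cdots((\bullet\bullet)\bullet)\cdots)\bullet$ be its least element. **Triangulations.** The canonical triangulation $T_n$ of $K_n$ is the simplicial complex on the vertex set $\mathrm{Br}_n$ defined recursively as follows: $T_2$ is a point, and in general $T_n$ ($n\ge 2$) is the cone with apex $\xi_n$ over $\bigcup \iota_t(T_a\times T_b)$, the union being over $a,b\ge 2$ with $a+b=n+1$ and $2\le t\le b$. Here $T_a\times T_b$ is the product triangulation of complexes ordered by $\prec$: a finite non-empty set of pairs is a simplex iff its two projections are simplices and it is totally ordered by the componentwise order. **Chains.**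 For $p\in\mathbb Z$, let $C_p(K_n)$ be the space of $p$-dimensional simplicial chains of $T_n$ with coefficients in $\mathbf k$, with simplices oriented by $\prec$; it has as a basis the $p$-simplices $[v_0,\dots,v_p]$, $v_0\prec\cdots\prec v_p$, of $T_n$, it is $0$ for $p<0$, and we set $C_p(K_n)=0$ for $n<2$. Let $d_S[v_0,\dots,v_p]=\sum_{i=0}^p(-1)^i[v_0,\dots,\widehat{v_i},\dots,v_p]$ for $p\ge1$ and $d_S[v_0]=0$. For $1\le t\le b$, $\mathbf s\in C_p(K_a)$ and $\mathbf t\in C_q(K_b)$ put $\mathbf s\diamond_t\mathbf t:=(\iota_t)_*(\mathbf s\times\mathbf t)$, where $\times$ is the simplicial cross product. Explicitly, $\diamond_t$ is bilinear and $$[v_0,\dots,v_p]\diamond_t[w_0,\dots,w_q]=\sum_{\phi}\operatorname{sgn}(\phi)\,[(v_{\phi'(0)},w_{\phi''(0)})_t,\dots,(v_{\phi'(p+q)},w_{\phi''(p+q)})_t],$$ where $\phi$ runs over the partitions of $\{1,\dots,p+q\}$ into $\{i_1<\cdots<i_p\}$ and $\{j_1<\cdots<j_q\}$, $\operatorname{sgn}(\phi)$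 is the signum of the permutation $(1,\dots,p+q)\mapsto(i_1,\dots,i_p,j_1,\dots,j_q)$, $\phi'(l)=\#\{m: i_m\le l\}$ and $\phi''(l)=\#\{m: j_m\le l\}$. **Proposition.** $(C_*(K_*),d_S)$ together with the operations $\diamond_t$ is a differential comp algebra. That is: 1. It is a bigraded differential space: the bigraded space is $\bigoplus_{p,n}C_p(K_n)$, $d_S(C_p(K_n))\subset C_{p-1}(K_n)$ and $d_S^2=0$. 2. For $1\le t\le b$, the operation $\diamond_t$ is a well-defined bilinear map $C_p(K_a)\times C_q(K_b)\to C_{p+q}(K_{a+b-1})$. 3. For $\mathbf s\in C_p(K_a)$, $\mathbf t\in C_q(K_b)$, $\mathbf u\in C_r(K_c)$, $1\le j\le c$ and $1\le i\le b+c-1$, $$\mathbf s\diamond_i(\mathbf t\diamond_j\mathbf u)=\begin{cases}(-1)^{pq}\,\mathbf t\diamond_{j+a-1}(\mathbf s\diamond_i\mathbf u),&1\le i\le j-1,\\(\mathbf s\diamond_{i-j+1}\mathbf t)\diamond_j\mathbf u,&j\le i\le b+j-1,\\(-1)^{pq}\,\mathbf t\diamond_j(\mathbf s\diamond_{i-b+1}\mathbf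 u),&i\ge j+b.\end{cases}$$ 4. For $\mathbf s\in C_p(K_a)$, $\mathbf t\in C_q(K_b)$ and $1\le t\le b$, $\ d_S(\mathbf s\diamond_t\mathbf t)=d_S(\mathbf s)\diamond_t\mathbf t+(-1)^p\,\mathbf s\diamond_t d_S(\mathbf t)$. -/

import Mathlib

noncomputable section

namespace Associahedron

/-! ### Bracketings: the vertices of the associahedra -/

/-- Full bracketings of finitely many (at least one) symbols `•`, that is, nonassociative words in
one letter. The full bracketings of `n` symbols are those with `u.length = n`. -/
abbrev Bracketing : Type := FreeMagma Unit

/-- The symbol `•`. -/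
abbrev dot : Bracketing := FreeMagma.of ()

/-- `insertAt u v t` is `(u, v)_t`: the bracketing `(u)` inserted at the `t`-th place of `v`, for
`1 ≤ t ≤ v.length` (places are counted from `1`, from left to right). -/
def insertAt (u : Bracketing) : Bracketing → ℕ → Bracketing
  | FreeMagma.of _, _ => u
  | FreeMagma.mul v w, t =>
    if t ≤ v.length then insertAt u v t * w else v * insertAt u w (t - v.length)

/-- One substitution `(w₁ w₂) w₃ ↦ w₁ (w₂ w₃)` somewhere inside a bracketing. -/
inductive Rebracket : Bracketing → Bracketing → Prop
  | assoc (w₁ w₂ w₃ : Bracketing) : Rebracket (w₁ * w₂ * w₃) (w₁ * (w₂ * w₃))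
  | left {u u' : Bracketing} (v : Bracketing) (h : Rebracket u u') : Rebracket (u * v) (u' * v)
  | right (u : Bracketing) {v v' : Bracketing} (h : Rebracket v v') : Rebracket (u * v) (u * v')

/-- The strict order `u ≺ v`, generated by the substitutions `(w₁ w₂) w₃ ↦ w₁ (w₂ w₃)`. -/
def Prec : Bracketing → Bracketing → Prop := Relation.TransGen Rebracket

/-- The reflexive order `u ≼ v` belonging to `≺`. -/
def PrecEq : Bracketing → Bracketing → Prop := Relation.ReflTransGen Rebracket

/-- The bracketing `ξ_n = (⋯((• •) •)⋯) •` of `n` symbols, for `1 ≤ n`. -/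
def leftComb : ℕ → Bracketing
  | 0 => dot
  | 1 => dot
  | n + 2 => leftComb (n + 1) * dot

theorem precEq_mul {u u' v v' : Bracketing} (h : PrecEq u u') (h' : PrecEq v v') :
    PrecEq (u * v) (u' * v') :=
  (Relation.ReflTransGen.lift (fun x => x * v) (fun _ _ => Rebracket.left v) _ _ h).trans
    (Relation.ReflTransGen.lift (fun x => u' * x) (fun _ _ => Rebracket.right u') _ _ h')

theorem leftComb_add (m n : ℕ) :
    PrecEq (leftComb (m + 1 + (n + 1))) (leftComb (m + 1) * leftComb (n + 1)) := by
  induction n with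
  | zero => exact Relation.ReflTransGen.refl
  | succ n ih =>
    exact (precEq_mul ih Relation.ReflTransGen.refl).tail (Rebracket.assoc _ _ _)

/-- `ξ_n` is the least bracketing of `n` symbols. -/
theorem leftComb_precEq (u : Bracketing) : PrecEq (leftComb u.length) u := by
  induction u with
  | of _ => exact Relation.ReflTransGen.refl
  | mul v w hv hw =>
    obtain ⟨m, hm⟩ := Nat.exists_eq_succ_of_ne_zero v.length_pos.ne'
    obtain ⟨n, hn⟩ := Nat.exists_eq_succ_of_ne_zero w.length_pos.ne'
    have h : PrecEq (leftComb (v.length + w.length)) (leftComb v.length * leftComb w.length) := by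
      rw [hm, hn]
      exact leftComb_add m n
    exact h.trans (precEq_mul hv hw)

/-! ### The canonical triangulations -/

/-- The cone with apex `x` over a simplicial complex `K`. -/
def cone {V : Type*} [DecidableEq V] (x : V) (K : PreAbstractSimplicialComplex V) :
    PreAbstractSimplicialComplex V where
  faces := {s | s = {x} ∨ s ∈ K ∨ ∃ σ ∈ K, s = insert x σ}
  isRelLowerSet_faces := by
    have key : ∀ s ∈ K, s.Nonempty ∧ ∀ ⦃t⦄, t ≤ s → t.Nonempty → t ∈ K :=
      fun s hs => K.isRelLowerSet_faces hs
    rintro s (rfl | hs | ⟨σ, hσ, rfl⟩)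
    · refine ⟨Finset.singleton_nonempty x, fun t ht hn => Or.inl ?_⟩
      exact (Finset.subset_singleton_iff.1 ht).resolve_left hn.ne_empty
    · exact ⟨(key s hs).1, fun t ht hn => Or.inr (Or.inl ((key s hs).2 ht hn))⟩
    · refine ⟨Finset.insert_nonempty x σ, fun t ht hn => ?_⟩
      have hsub : t.erase x ⊆ σ := by
        intro y hy
        rcases Finset.mem_erase.1 hy with ⟨hyx, hyt⟩
        exact (Finset.mem_insert.1 (ht hyt)).resolve_left hyx
      by_cases hx : x ∈ t
      · rcases (t.erase x).eq_empty_or_nonempty with he | he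
        · left
          rw [← Finset.insert_erase hx, he]
          rfl
        · exact Or.inr (Or.inr ⟨t.erase x, (key σ hσ).2 hsub he, (Finset.insert_erase hx).symm⟩)
      · rw [Finset.erase_eq_of_notMem hx] at hsub
        exact Or.inr (Or.inl ((key σ hσ).2 hsub hn))

/-- The product triangulation of two simplicial complexes of bracketings, ordered by `≼`: a finite
set of pairs is a simplex if its two projections are simplices and it is totally ordered by the
componentwise order. -/
def orderedProd (K L : PreAbstractSimplicialComplex Bracketing) :
    PreAbstractSimplicialComplex (Bracketing × Bracketing) where
  faces := {σ | σ.image Prod.fst ∈ K ∧ σ.image Prod.snd ∈ L ∧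
    ∀ x ∈ σ, ∀ y ∈ σ, (PrecEq x.1 y.1 ∧ PrecEq x.2 y.2) ∨ (PrecEq y.1 x.1 ∧ PrecEq y.2 x.2)}
  isRelLowerSet_faces := by
    rintro σ ⟨h₁, h₂, h₃⟩
    refine ⟨Finset.image_nonempty.1 (K.isRelLowerSet_faces h₁).1, fun τ hτ hn => ⟨?_, ?_, ?_⟩⟩
    · exact (K.isRelLowerSet_faces h₁).2 (Finset.image_subset_image hτ) (hn.image _)
    · exact (L.isRelLowerSet_faces h₂).2 (Finset.image_subset_image hτ) (hn.image _)
    · exact fun x hx y hy => h₃ x (hτ hx) y (hτ hy)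

/-- The map `ι_t : K_a × K_b → K_{a+b-1}` on vertices. -/
def iota (t : ℕ) (p : Bracketing × Bracketing) : Bracketing := insertAt p.1 p.2 t

/-- The canonical triangulation `T_n` of the associahedron `K_n` (`n ≥ 2`), as a simplicial complex
on the full bracketings of `n` symbols: the cone with apex `ξ_n` over the union of the
`ι_t (T_a × T_b)` with `a + b = n + 1`, `a, b ≥ 2` and `2 ≤ t ≤ b`. In particular `T_2` is a point.
For `n < 2` there is no associahedron and the complex is empty. -/
def triangulation (n : ℕ) : PreAbstractSimplicialComplex Bracketing :=
  if 2 ≤ n then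
    cone (leftComb n)
      (⨆ (a : ℕ) (b : ℕ) (t : ℕ) (_ : 2 ≤ a ∧ 2 ≤ b ∧ a + b = n + 1 ∧ 2 ≤ t ∧ t ≤ b),
        (orderedProd (triangulation a) (triangulation b)).map (iota t))
  else ⊥
termination_by n
decreasing_by all_goals omega

/-! ### Simplicial chains, the differential and the cross product -/

section Chains

variable (k : Type*) [CommRing k]

/-- Formal `k`-linear combinations of finite sequences `[v₀, …, v_p]` of vertices in `V`. -/
abbrev Seqs (V : Type*) : Type _ := List V →₀ k

/-- `C_p(K_n)`: the `p`-dimensional oriented simplicial chains of `T_n`. It is spanned by the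
`p`-simplices of `T_n`, each written as `[v₀, …, v_p]` with `v₀ ≺ ⋯ ≺ v_p`. It is zero for
`p < 0`, and for `n < 2`. -/
def chains (p : ℤ) (n : ℕ) : Submodule k (Seqs k Bracketing) :=
  Finsupp.supported k k
    {l : List Bracketing | (l.length : ℤ) = p + 1 ∧ l.Pairwise Prec ∧
      l.toFinset ∈ triangulation n}

/-- The simplicial differential
`d [v₀, …, v_p] = ∑ i, (-1)^i [v₀, …, v_{i-1}, v_{i+1}, …, v_p]` for `p ≥ 1`, and `d [v₀] = 0`. -/
def boundary (V : Type*) : Seqs k V →ₗ[k] Seqs k V :=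
  Finsupp.linearCombination k fun l : List V =>
    if l.length ≤ 1 then 0
    else ∑ i ∈ Finset.range l.length, Finsupp.single (l.eraseIdx i) ((-1 : k) ^ i)

/-- The signum of the shuffle of `{1, …, m}` given by `I = {i₁ < ⋯ < i_r}` and its complement
`{j₁ < ⋯ < j_s}`: the signum of the permutation `(1, …, m) ↦ (i₁, …, i_r, j₁, …, j_s)`, computed by
counting inversions. -/
def shuffleSign (m : ℕ) (I : Finset ℕ) : k :=
  (-1) ^ ((I ×ˢ (Finset.Icc 1 m \ I)).filter fun x => x.2 < x.1).card

/-- The sequence of pairs `(v_{φ'(l)}, w_{φ''(l)})`, `0 ≤ l ≤ m`, for the shuffle `φ` of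
`{1, …, m}` given by `I` and its complement `J`, where `φ'(l)` and `φ''(l)` are the numbers of
elements `≤ l` in `I` and in `J`. -/
def shufflePath {V W : Type*} (v : List V) (w : List W) (m : ℕ) (I : Finset ℕ) : List (V × W) :=
  ((List.range (m + 1)).filterMap fun l => v[(I.filter fun i => i ≤ l).card]?).zip
    ((List.range (m + 1)).filterMap fun l => w[((Finset.Icc 1 m \ I).filter fun j => j ≤ l).card]?)

/-- The simplicial cross product on two simplices `v = [v₀, …, v_r]` and `w = [w₀, …, w_s]`:
the signed sum over all `(r, s)`-shuffles. -/
def crossSimplex {V W : Type*} (v : List V) (w : List W) : Seqs k (V × W) :=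
  ∑ I ∈ (Finset.Icc 1 ((v.length - 1) + (w.length - 1))).powersetCard (v.length - 1),
    Finsupp.single (shufflePath v w ((v.length - 1) + (w.length - 1)) I)
      (shuffleSign k ((v.length - 1) + (w.length - 1)) I)

/-- The simplicial cross product `s × t`, extended bilinearly. -/
def cross (V W : Type*) : Seqs k V →ₗ[k] Seqs k W →ₗ[k] Seqs k (V × W) :=
  Finsupp.linearCombination k fun v : List V =>
    Finsupp.linearCombination k fun w : List W => crossSimplex k v w

/-- The map `f_*` on chains induced by an (injective) map `f` of vertices. -/
def pushforward {V W : Type*} (f : V → W) : Seqs k V →ₗ[k] Seqs k W :=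
  Finsupp.lmapDomain k k (List.map f)

/-- The product `s ⋄_t t' = (ι_t)_* (s × t')`. -/
def diamond (t : ℕ) :
    Seqs k Bracketing →ₗ[k] Seqs k Bracketing →ₗ[k] Seqs k Bracketing :=
  (cross k Bracketing Bracketing).compr₂ (pushforward k (iota t))

end Chains

end Associahedron

/-- A (right) differential comp algebra over `k`. The bigraded space is given by independent
submodules `X p a` (`p` the homological degree, `a` the arity) of an ambient module `M`, so that it
is their internal direct sum. The differential and the operations `⋄_t` are given by (bi)linear maps
of `M`; only their values on the pieces `X p a` (and only for `1 ≤ t ≤ b` on `X p a × X q b`)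
matter. -/
structure IsDifferentialCompAlgebra {k M : Type*} [CommRing k] [AddCommGroup M] [Module k M]
    (X : ℤ → ℕ → Submodule k M) (d : M →ₗ[k] M) (op : ℕ → M →ₗ[k] M →ₗ[k] M) : Prop where
  /-- The sum of the pieces `X p a` is direct. -/
  independent : iSupIndep fun i : ℤ × ℕ => X i.1 i.2
  /-- The differential lowers the homological degree by one. -/
  d_mem : ∀ (p : ℤ) (a : ℕ), ∀ s ∈ X p a, d s ∈ X (p - 1) a
  /-- The differential has square zero. -/
  d_d : ∀ (p : ℤ) (a : ℕ), ∀ s ∈ X p a, d (d s) = 0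
  /-- `⋄_t` maps `X p a × X q b` to `X (p + q) (a + b - 1)` for `1 ≤ t ≤ b`. -/
  op_mem : ∀ (p q : ℤ) (a b t : ℕ), 1 ≤ t → t ≤ b →
    ∀ s ∈ X p a, ∀ s' ∈ X q b, op t s s' ∈ X (p + q) (a + b - 1)
  /-- Associativity, for `1 ≤ i ≤ j - 1`. -/
  assoc_left : ∀ (p q r : ℤ) (a b c i j : ℕ), 1 ≤ j → j ≤ c → 1 ≤ i → i ≤ b + c - 1 →
    ∀ s ∈ X p a, ∀ t ∈ X q b, ∀ u ∈ X r c, i ≤ j - 1 →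
      op i s (op j t u) = (p * q).negOnePow • op (j + a - 1) t (op i s u)
  /-- Associativity, for `j ≤ i ≤ b + j - 1`. -/
  assoc_mid : ∀ (p q r : ℤ) (a b c i j : ℕ), 1 ≤ j → j ≤ c → 1 ≤ i → i ≤ b + c - 1 →
    ∀ s ∈ X p a, ∀ t ∈ X q b, ∀ u ∈ X r c, j ≤ i → i ≤ b + j - 1 →
      op i s (op j t u) = op j (op (i - j + 1) s t) u
  /-- Associativity, for `i ≥ j + b`. -/
  assoc_right : ∀ (p q r : ℤ) (a b c i j : ℕ), 1 ≤ j → j ≤ c → 1 ≤ i → i ≤ b + c - 1 →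
    ∀ s ∈ X p a, ∀ t ∈ X q b, ∀ u ∈ X r c, j + b ≤ i →
      op i s (op j t u) = (p * q).negOnePow • op j t (op (i - b + 1) s u)
  /-- The Leibniz rule. -/
  leibniz : ∀ (p q : ℤ) (a b t : ℕ), 1 ≤ t → t ≤ b → ∀ s ∈ X p a, ∀ s' ∈ X q b,
    d (op t s s') = op t (d s) s' + p.negOnePow • op t s (d s')

end

noncomputable section

namespace Associahedron

/-! ### Insertion of bracketings -/

/-! All identities are multilinear, so they may be checked on single simplices. There `diamond` is
the cross product followed by `iota`, and two independent kinds of identities combine: rules for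
nested insertions of bracketings, and rules for signed shuffles of abstract sequences. The shuffle
product is associative and graded commutative up to relabelling vertices
(`pushforward_shuffle_assoc`, `pushforward_shuffle_comm`); the relabellings match by the three
`insertAt_insertAt_*` lemmas, which gives the three associativity laws. The Leibniz rule is
`boundary_shuffle` together with the naturality of the boundary.

The geometric point is that products of simplices stay inside the triangulation. Insertion is
strictly monotone in both arguments, so shuffle paths become strict chains. For places at least 2
the image is a base simplex by construction. For place 1 (`image_iota_one_mem`) one uses induction
on `a + b`: the pair of apexes goes to the apex, and a totally ordered simplex without that pair
misses the apex in one projection. That projection then comes from a smaller product, and a nested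
insertion identity turns place 1 into a place at least 2.

The shuffle identities are proved by induction on lists. Admitting the empty sequence and the
augmented differential `[v₀] ↦ []` gives the uniform rule `∂(x·z) = z - x·∂z`, and a product is
determined by its first step. `dropNil` returns to ordinary chains, and `shuffleSum_eq` identifies
the recursive product with the explicit sum over subsets. -/

@[simp] theorem insertAt_of (u : Bracketing) (x : Unit) (t : ℕ) :
    insertAt u (FreeMagma.of x) t = u := rfl

theorem insertAt_mul (u v w : Bracketing) (t : ℕ) : insertAt u (v * w) t =
    if t ≤ v.length then insertAt u v t * w else v * insertAt u w (t - v.length) := rfl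

theorem insertAt_mul_of_le (u : Bracketing) {v : Bracketing} (w : Bracketing) {t : ℕ}
    (h : t ≤ v.length) : insertAt u (v * w) t = insertAt u v t * w := by
  rw [insertAt_mul, if_pos h]

theorem insertAt_mul_of_lt (u : Bracketing) {v : Bracketing} (w : Bracketing) {t : ℕ}
    (h : v.length < t) : insertAt u (v * w) t = v * insertAt u w (t - v.length) := by
  rw [insertAt_mul, if_neg h.not_ge]

@[simp] theorem length_of (x : Unit) : (FreeMagma.of x : Bracketing).length = 1 := rfl

@[simp] theorem length_mul (v w : Bracketing) : (v * w).length = v.length + w.length := rfl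

theorem length_insertAt (u v : Bracketing) (t : ℕ) :
    (insertAt u v t).length + 1 = u.length + v.length := by
  induction v using FreeMagma.recOnMul generalizing t with
  | ih1 _ => simp
  | ih2 v w hv hw =>
    have h₁ := hv t
    have h₂ := hw (t - v.length)
    rw [insertAt_mul]
    split_ifs <;> simp only [length_mul] <;> omega

/-- The two insertions replace different symbols of `u`, so they commute; the word put at the
earlier place moves the later one by `s.length - 1`. The induction distinguishes whether the top
product of `u` separates the two places. -/
theorem insertAt_insertAt_left (s t u : Bracketing) {i j : ℕ} (hi : 1 ≤ i) (hij : i < j)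
    (hj : j ≤ u.length) :
    insertAt s (insertAt t u j) i = insertAt t (insertAt s u i) (j + s.length - 1) := by
  induction u using FreeMagma.recOnMul generalizing i j with
  | ih1 _ => simp at hj; omega
  | ih2 v w hv hw =>
    rw [length_mul] at hj
    have hs := s.length_pos
    have ht := t.length_pos
    by_cases h₁ : j ≤ v.length
    · have l₁ := length_insertAt t v j
      have l₂ := length_insertAt s v i
      rw [insertAt_mul_of_le _ _ h₁, insertAt_mul_of_le s _ (by omega : i ≤ v.length),
        insertAt_mul_of_le _ _ (by omega), insertAt_mul_of_le _ _ (by omega), hv hi hij h₁]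
    · by_cases h₂ : i ≤ v.length
      · have l₂ := length_insertAt s v i
        rw [insertAt_mul_of_lt _ _ (by omega : v.length < j), insertAt_mul_of_le _ _ h₂,
          insertAt_mul_of_le _ _ h₂, insertAt_mul_of_lt _ _ (by omega)]
        congr 2
        omega
      · rw [insertAt_mul_of_lt _ _ (by omega : v.length < j),
          insertAt_mul_of_lt _ _ (by omega : v.length < i),
          insertAt_mul_of_lt _ _ (by omega), insertAt_mul_of_lt _ _ (by omega),
          hw (by omega) (by omega) (by omega)]
        congr 2
        omega

/-- Here place `i` lies inside the inserted copy of `t`, at its place `i - j + 1`. -/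
theorem insertAt_insertAt_mid (s t u : Bracketing) {i j : ℕ} (hj : 1 ≤ j) (hju : j ≤ u.length)
    (hji : j ≤ i) (hi : i ≤ t.length + j - 1) :
    insertAt s (insertAt t u j) i = insertAt (insertAt s t (i - j + 1)) u j := by
  induction u using FreeMagma.recOnMul generalizing i j with
  | ih1 _ =>
    obtain rfl : j = 1 := by simp at hju; omega
    rw [insertAt_of, insertAt_of, Nat.sub_add_cancel hji]
  | ih2 v w hv hw =>
    rw [length_mul] at hju
    have ht := t.length_pos
    by_cases h₁ : j ≤ v.length
    · have l₁ := length_insertAt t v j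
      rw [insertAt_mul_of_le _ _ h₁, insertAt_mul_of_le _ _ h₁,
        insertAt_mul_of_le _ _ (by omega), hv hj h₁ hji hi]
    · rw [insertAt_mul_of_lt _ _ (by omega : v.length < j),
        insertAt_mul_of_lt _ _ (by omega : v.length < j),
        insertAt_mul_of_lt _ _ (by omega : v.length < i),
        hw (by omega) (by omega) (by omega) (by omega)]
      congr 3
      omega

/-- The left case read backwards, with `s` and `t` exchanged. -/
theorem insertAt_insertAt_right (s t u : Bracketing) {i j : ℕ} (hj : 1 ≤ j)
    (hji : j + t.length ≤ i) (hi : i ≤ t.length + u.length - 1) :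
    insertAt s (insertAt t u j) i = insertAt t (insertAt s u (i - t.length + 1)) j := by
  have ht := t.length_pos
  rw [insertAt_insertAt_left t s u (i := j) (j := i - t.length + 1) hj (by omega) (by omega)]
  congr 1
  omega

/-! ### The order on bracketings -/

theorem Rebracket.length_eq {u v : Bracketing} (h : Rebracket u v) : u.length = v.length := by
  induction h with
  | assoc => simp [add_assoc]
  | left _ _ ih => simp [ih]
  | right _ _ ih => simp [ih]

/-- The sum of the sizes of the left factors of all products occurring in a bracketing. -/
def leftWeight : Bracketing → ℕ
  | FreeMagma.of _ => 0
  | FreeMagma.mul v w => leftWeight v + leftWeight w + v.length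

theorem leftWeight_mul (v w : Bracketing) :
    leftWeight (v * w) = leftWeight v + leftWeight w + v.length := rfl

/-- Reassociating `(a b) c` lowers the weight by exactly `a.length`; since lengths are preserved,
the surrounding context does not affect the difference. This makes the order antisymmetric. -/
theorem Rebracket.leftWeight_lt {u v : Bracketing} (h : Rebracket u v) :
    leftWeight v < leftWeight u := by
  induction h with
  | assoc a b c =>
    have := a.length_pos
    simp only [leftWeight_mul, length_mul]
    omega
  | left v h ih =>
    have := h.length_eq
    simp only [leftWeight_mul]
    omega
  | right v h ih =>
    simp only [leftWeight_mul]
    omega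

theorem Prec.leftWeight_lt {u v : Bracketing} (h : Prec u v) : leftWeight v < leftWeight u := by
  induction h with
  | single h => exact h.leftWeight_lt
  | tail _ h ih => exact h.leftWeight_lt.trans ih

theorem Prec.trans {u v w : Bracketing} (h : Prec u v) (h' : Prec v w) : Prec u w :=
  Relation.TransGen.trans h h'

theorem Prec.precEq {u v : Bracketing} (h : Prec u v) : PrecEq u v :=
  Relation.TransGen.to_reflTransGen h

theorem PrecEq.refl (u : Bracketing) : PrecEq u u := Relation.ReflTransGen.refl

theorem PrecEq.antisymm {u v : Bracketing} (h : PrecEq u v) (h' : PrecEq v u) : u = v := by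
  rcases Relation.reflTransGen_iff_eq_or_transGen.1 h with rfl | h
  · rfl
  rcases Relation.reflTransGen_iff_eq_or_transGen.1 h' with rfl | h'
  · rfl
  exact absurd (Prec.leftWeight_lt h) (Prec.leftWeight_lt h').asymm

theorem Rebracket.insertAt_left {u u' : Bracketing} (h : Rebracket u u') (v : Bracketing) (t : ℕ) :
    Rebracket (insertAt u v t) (insertAt u' v t) := by
  induction v using FreeMagma.recOnMul generalizing t with
  | ih1 _ => exact h
  | ih2 v w hv hw =>
    rw [insertAt_mul, insertAt_mul]
    split_ifs
    · exact (hv t).left w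
    · exact (hw _).right v

/-- The place lies in one of the three factors of the reassociated product, and the same move
applies with that factor enlarged. -/
theorem Rebracket.insertAt_right (u : Bracketing) {v v' : Bracketing} (h : Rebracket v v') (t : ℕ) :
    Rebracket (insertAt u v t) (insertAt u v' t) := by
  induction h generalizing t with
  | assoc a b c =>
    by_cases h₁ : t ≤ a.length
    · rw [insertAt_mul_of_le _ _ (by rw [length_mul]; omega), insertAt_mul_of_le _ _ h₁,
        insertAt_mul_of_le _ _ h₁]
      exact Rebracket.assoc _ _ _
    · by_cases h₂ : t ≤ a.length + b.length
      · rw [insertAt_mul_of_le _ _ (by rw [length_mul]; omega),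
          insertAt_mul_of_lt _ _ (by omega : a.length < t),
          insertAt_mul_of_lt _ _ (by omega : a.length < t), insertAt_mul_of_le _ _ (by omega)]
        exact Rebracket.assoc _ _ _
      · rw [insertAt_mul_of_lt _ _ (by rw [length_mul]; omega),
          insertAt_mul_of_lt _ _ (by omega : a.length < t), insertAt_mul_of_lt _ _ (by omega),
          length_mul, Nat.sub_sub]
        exact Rebracket.assoc _ _ _
  | left w h ih =>
    rw [insertAt_mul, insertAt_mul, h.length_eq]
    split_ifs
    · exact (ih t).left w
    · exact h.left _
  | right w h ih =>
    rw [insertAt_mul, insertAt_mul]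
    split_ifs
    · exact h.right _
    · exact (ih _).right w

theorem Prec.insertAt_left {u u' : Bracketing} (h : Prec u u') (v : Bracketing) (t : ℕ) :
    Prec (insertAt u v t) (insertAt u' v t) :=
  Relation.TransGen.lift (fun x => insertAt x v t) (fun _ _ h => h.insertAt_left v t) _ _ h

theorem Prec.insertAt_right (u : Bracketing) {v v' : Bracketing} (h : Prec v v') (t : ℕ) :
    Prec (insertAt u v t) (insertAt u v' t) :=
  Relation.TransGen.lift (fun x => insertAt u x t) (fun _ _ h => h.insertAt_right u t) _ _ h

theorem precEq_insertAt {u u' v v' : Bracketing} (h : PrecEq u u') (h' : PrecEq v v') (t : ℕ) :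
    PrecEq (insertAt u v t) (insertAt u' v' t) :=
  (Relation.ReflTransGen.lift (fun x => insertAt x v t) (fun _ _ h => h.insertAt_left v t) _ _
    h).trans
    (Relation.ReflTransGen.lift (fun x => insertAt u' x t) (fun _ _ h => h.insertAt_right u' t) _ _
      h')

theorem leftComb_succ {n : ℕ} (hn : 1 ≤ n) : leftComb (n + 1) = leftComb n * dot := by
  obtain ⟨m, rfl⟩ := Nat.exists_eq_succ_of_ne_zero (by omega : n ≠ 0)
  rfl

theorem length_leftComb {n : ℕ} (hn : 1 ≤ n) : (leftComb n).length = n := by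
  induction n, hn using Nat.le_induction with
  | base => rfl
  | succ n hn ih => rw [leftComb_succ hn, length_mul, ih, length_of]

/-- This is why `iota 1` sends the pair of apexes to the apex. -/
theorem insertAt_leftComb {a b : ℕ} (ha : 1 ≤ a) (hb : 1 ≤ b) :
    insertAt (leftComb a) (leftComb b) 1 = leftComb (a + b - 1) := by
  induction b, hb using Nat.le_induction with
  | base => rfl
  | succ b hb ih =>
    rw [leftComb_succ hb, insertAt_mul_of_le _ _ (by rwa [length_leftComb hb]), ih,
      show a + (b + 1) - 1 = a + b - 1 + 1 by omega, leftComb_succ (by omega)]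

/-! ### The faces of the canonical triangulations -/

/-- The simplices of the base of the cone `triangulation n`. -/
def IsBaseFace (n : ℕ) (s : Finset Bracketing) : Prop :=
  ∃ a b t : ℕ, (2 ≤ a ∧ 2 ≤ b ∧ a + b = n + 1 ∧ 2 ≤ t ∧ t ≤ b) ∧
    ∃ ρ ∈ orderedProd (triangulation a) (triangulation b), ρ.image (iota t) = s

theorem _root_.PreAbstractSimplicialComplex.mem_iSup {V : Type*} {ι : Sort*}
    {K : ι → PreAbstractSimplicialComplex V} {s : Finset V} : s ∈ ⨆ i, K i ↔ ∃ i, s ∈ K i := by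
  change s ∈ ⋃ L ∈ Set.range K, L.faces ↔ _
  simp
  rfl

theorem mem_triangulation {n : ℕ} {s : Finset Bracketing} : s ∈ triangulation n ↔
    2 ≤ n ∧ (s = {leftComb n} ∨ IsBaseFace n s ∨ ∃ σ, IsBaseFace n σ ∧ s = insert (leftComb n) σ) := by
  rw [triangulation]
  split_ifs with h
  · have key : ∀ σ : Finset Bracketing, σ ∈ (⨆ (a : ℕ) (b : ℕ) (t : ℕ)
        (_ : 2 ≤ a ∧ 2 ≤ b ∧ a + b = n + 1 ∧ 2 ≤ t ∧ t ≤ b),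
        (orderedProd (triangulation a) (triangulation b)).map (iota t)) ↔ IsBaseFace n σ := by
      intro σ
      simp only [PreAbstractSimplicialComplex.mem_iSup, exists_prop]
      rfl
    simp only [h, true_and, ← key]
    rfl
  · simp only [h, false_and, iff_false]
    exact fun h => h

theorem triangulation_mono {n : ℕ} {s t : Finset Bracketing} (hs : s ∈ triangulation n)
    (h : t ⊆ s) (ht : t.Nonempty) : t ∈ triangulation n :=
  ((triangulation n).isRelLowerSet_faces hs).2 h ht

theorem IsBaseFace.mem {n : ℕ} {s : Finset Bracketing} (h : IsBaseFace n s) :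
    s ∈ triangulation n := by
  refine mem_triangulation.2 ⟨?_, Or.inr (Or.inl h)⟩
  obtain ⟨a, b, t, h, -⟩ := h
  omega

theorem IsBaseFace.insert_mem {n : ℕ} {s : Finset Bracketing} (h : IsBaseFace n s) :
    insert (leftComb n) s ∈ triangulation n :=
  mem_triangulation.2 ⟨(mem_triangulation.1 h.mem).1, Or.inr (Or.inr ⟨s, h, rfl⟩)⟩

theorem isBaseFace_of_notMem {n : ℕ} {s : Finset Bracketing} (h : s ∈ triangulation n)
    (hs : leftComb n ∉ s) : IsBaseFace n s := by
  obtain ⟨-, rfl | h | ⟨σ, -, rfl⟩⟩ := mem_triangulation.1 h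
  · simp at hs
  · exact h
  · simp at hs

theorem two_le_of_mem {n : ℕ} {s : Finset Bracketing} (h : s ∈ triangulation n) : 2 ≤ n :=
  (mem_triangulation.1 h).1

theorem nonempty_of_mem {n : ℕ} {s : Finset Bracketing} (h : s ∈ triangulation n) : s.Nonempty :=
  ((triangulation n).isRelLowerSet_faces h).1

/-- The insertion identities refer to places, hence to exact lengths of vertices; it also lets a
simplex determine its arity. -/
theorem length_of_mem {n : ℕ} {s : Finset Bracketing} (h : s ∈ triangulation n) :
    ∀ u ∈ s, u.length = n := by
  induction n using Nat.strong_induction_on generalizing s with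
  | _ n ih =>
    have base : ∀ σ, IsBaseFace n σ → ∀ u ∈ σ, u.length = n := by
      rintro σ ⟨a, b, t, hab, ρ, ⟨h₁, h₂, -⟩, rfl⟩ u hu
      obtain ⟨p, hp, rfl⟩ := Finset.mem_image.1 hu
      have l₁ := ih a (by omega) h₁ p.1 (Finset.mem_image_of_mem _ hp)
      have l₂ := ih b (by omega) h₂ p.2 (Finset.mem_image_of_mem _ hp)
      have := length_insertAt p.1 p.2 t
      unfold iota
      omega
    obtain ⟨hn, rfl | h | ⟨σ, hσ, rfl⟩⟩ := mem_triangulation.1 h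
    · intro u hu
      rw [Finset.mem_singleton.1 hu, length_leftComb (by omega)]
    · exact base s h
    · intro u hu
      rcases Finset.mem_insert.1 hu with rfl | hu
      · rw [length_leftComb (by omega)]
      · exact base σ hσ u hu

/-- On a simplex of an ordered product, `iota t` has a monotone section. -/
theorem exists_section {K L : PreAbstractSimplicialComplex Bracketing}
    {ρ : Finset (Bracketing × Bracketing)} (hρ : ρ ∈ orderedProd K L) (t : ℕ) :
    ∃ g : Bracketing → Bracketing × Bracketing, ∀ u ∈ ρ.image (iota t),
      g u ∈ ρ ∧ iota t (g u) = u ∧ ∀ v ∈ ρ.image (iota t), PrecEq u v →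
        PrecEq (g u).1 (g v).1 ∧ PrecEq (g u).2 (g v).2 := by
  have h : ∀ u : Bracketing, ∃ p, u ∈ ρ.image (iota t) → p ∈ ρ ∧ iota t p = u := by
    intro u
    by_cases hu : u ∈ ρ.image (iota t)
    · obtain ⟨p, hp⟩ := Finset.mem_image.1 hu
      exact ⟨p, fun _ => hp⟩
    · exact ⟨(u, u), fun h => absurd h hu⟩
  choose g hg using h
  refine ⟨g, fun u hu => ⟨(hg u hu).1, (hg u hu).2, fun v hv huv => ?_⟩⟩
  rcases hρ.2.2 _ (hg u hu).1 _ (hg v hv).1 with h | h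
  · exact h
  -- The opposite comparison forces `u = v` by antisymmetry, so injectivity of `iota t` is not
  -- needed.
  · have hvu := precEq_insertAt h.1 h.2 t
    change PrecEq (iota t (g v)) (iota t (g u)) at hvu
    rw [(hg u hu).2, (hg v hv).2] at hvu
    rw [huv.antisymm hvu]
    exact ⟨PrecEq.refl _, PrecEq.refl _⟩

theorem image_iota_mem_of_two_le {a b t : ℕ} (ht : 2 ≤ t) (htb : t ≤ b)
    {σ : Finset (Bracketing × Bracketing)}
    (hσ : σ ∈ orderedProd (triangulation a) (triangulation b)) :
    IsBaseFace (a + b - 1) (σ.image (iota t)) := by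
  have ha := two_le_of_mem hσ.1
  have hb := two_le_of_mem hσ.2.1
  exact ⟨a, b, t, by omega, σ, hσ, rfl⟩

/-- `ι_1(T_a × T_b) ⊆ T_{a+b-1}`: apart from the apex `ι_1(ξ_a, ξ_b) = ξ_{a+b-1}`, every simplex lies
in the base of the cone. -/
theorem image_iota_one_mem {a b : ℕ} {σ : Finset (Bracketing × Bracketing)}
    (hσ : σ ∈ orderedProd (triangulation a) (triangulation b)) :
    σ.image (iota 1) ∈ triangulation (a + b - 1) := by
  induction hm : a + b using Nat.strong_induction_on generalizing a b σ with
  | _ m ih =>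
  subst hm
  have ha := two_le_of_mem hσ.1
  have hb := two_le_of_mem hσ.2.1
  -- The first projection is a base face, so `u = (x, y)_s` with `s ≥ 2`, and `((x, y)_s, v)_1 = (x,
  -- (y, v)_1)_s`. The pairs `(y, v)` form `κ`, to which the induction hypothesis applies.
  have left : ∀ τ ∈ orderedProd (triangulation a) (triangulation b),
      leftComb a ∉ τ.image Prod.fst → IsBaseFace (a + b - 1) (τ.image (iota 1)) := by
    intro τ hτ hξ
    obtain ⟨a', b', s, hs, ρ, hρ, hρτ⟩ := isBaseFace_of_notMem hτ.1 hξ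
    obtain ⟨g, hg⟩ := exists_section hρ s
    rw [hρτ] at hg
    have hfst : ∀ x ∈ τ, x.1 ∈ τ.image Prod.fst := fun x hx => Finset.mem_image_of_mem _ hx
    let κ : Finset (Bracketing × Bracketing) := τ.image fun x => ((g x.1).2, x.2)
    have hκ : κ ∈ orderedProd (triangulation b') (triangulation b) := by
      refine ⟨triangulation_mono hρ.2.1 ?_ ?_, triangulation_mono hτ.2.1 ?_ ?_, ?_⟩
      · simp only [κ, Finset.image_image]
        intro y hy
        obtain ⟨x, hx, rfl⟩ := Finset.mem_image.1 hy
        exact Finset.mem_image.2 ⟨_, (hg _ (hfst x hx)).1, rfl⟩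
      · simpa [κ] using nonempty_of_mem hτ.1
      · simp only [κ, Finset.image_image]
        exact subset_rfl
      · simpa [κ] using nonempty_of_mem hτ.1
      · simp only [κ, Finset.forall_mem_image]
        intro x hx y hy
        rcases hτ.2.2 x hx y hy with h | h
        · exact Or.inl ⟨((hg _ (hfst x hx)).2.2 _ (hfst y hy) h.1).2, h.2⟩
        · exact Or.inr ⟨((hg _ (hfst y hy)).2.2 _ (hfst x hx) h.1).2, h.2⟩
    have hκ' := ih (b' + b) (by omega) hκ rfl
    refine ⟨a', b' + b - 1, s, by omega, τ.image fun x => ((g x.1).1, insertAt (g x.1).2 x.2 1),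
      ⟨triangulation_mono hρ.1 ?_ ?_, ?_, ?_⟩, ?_⟩
    · simp only [Finset.image_image]
      intro y hy
      obtain ⟨x, hx, rfl⟩ := Finset.mem_image.1 hy
      exact Finset.mem_image.2 ⟨_, (hg _ (hfst x hx)).1, rfl⟩
    · simpa using nonempty_of_mem hτ.1
    · convert hκ' using 1
      simp only [κ, Finset.image_image]
      rfl
    · simp only [Finset.forall_mem_image]
      intro x hx y hy
      rcases hτ.2.2 x hx y hy with h | h
      · have := (hg _ (hfst x hx)).2.2 _ (hfst y hy) h.1
        exact Or.inl ⟨this.1, precEq_insertAt this.2 h.2 1⟩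
      · have := (hg _ (hfst y hy)).2.2 _ (hfst x hx) h.1
        exact Or.inr ⟨this.1, precEq_insertAt this.2 h.2 1⟩
    · rw [Finset.image_image]
      refine Finset.image_congr fun x hx => ?_
      have hx' := hg _ (hfst x hx)
      have l₁ := length_of_mem hρ.2.1 _ (Finset.mem_image_of_mem Prod.snd hx'.1)
      have l₂ := length_of_mem hτ.2.1 _ (Finset.mem_image_of_mem Prod.snd hx)
      simp only [Function.comp, iota]
      rw [insertAt_insertAt_mid _ _ _ le_rfl (by omega) (by omega) (by omega),
        Nat.sub_add_cancel (by omega)]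
      exact congrArg (fun y => insertAt y x.2 1) hx'.2.1
  -- Now `v = (x, y)_s` and `(u, (x, y)_s)_1 = (x, (u, y)_1)_{s+a-1}`; again the new place is at
  -- least 2 and `κ` consists of the pairs `(u, y)`.
  have right : ∀ τ ∈ orderedProd (triangulation a) (triangulation b),
      leftComb b ∉ τ.image Prod.snd → IsBaseFace (a + b - 1) (τ.image (iota 1)) := by
    intro τ hτ hξ
    obtain ⟨a', b', s, hs, ρ, hρ, hρτ⟩ := isBaseFace_of_notMem hτ.2.1 hξ
    obtain ⟨g, hg⟩ := exists_section hρ s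
    rw [hρτ] at hg
    have hsnd : ∀ x ∈ τ, x.2 ∈ τ.image Prod.snd := fun x hx => Finset.mem_image_of_mem _ hx
    let κ : Finset (Bracketing × Bracketing) := τ.image fun x => (x.1, (g x.2).2)
    have hκ : κ ∈ orderedProd (triangulation a) (triangulation b') := by
      refine ⟨triangulation_mono hτ.1 ?_ ?_, triangulation_mono hρ.2.1 ?_ ?_, ?_⟩
      · simp only [κ, Finset.image_image]
        exact subset_rfl
      · simpa [κ] using nonempty_of_mem hτ.1
      · simp only [κ, Finset.image_image]
        intro y hy
        obtain ⟨x, hx, rfl⟩ := Finset.mem_image.1 hy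
        exact Finset.mem_image.2 ⟨_, (hg _ (hsnd x hx)).1, rfl⟩
      · simpa [κ] using nonempty_of_mem hτ.1
      · simp only [κ, Finset.forall_mem_image]
        intro x hx y hy
        rcases hτ.2.2 x hx y hy with h | h
        · exact Or.inl ⟨h.1, ((hg _ (hsnd x hx)).2.2 _ (hsnd y hy) h.2).2⟩
        · exact Or.inr ⟨h.1, ((hg _ (hsnd y hy)).2.2 _ (hsnd x hx) h.2).2⟩
    have hκ' := ih (a + b') (by omega) hκ rfl
    refine ⟨a', a + b' - 1, s + a - 1, by omega,
      τ.image fun x => ((g x.2).1, insertAt x.1 (g x.2).2 1),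
      ⟨triangulation_mono hρ.1 ?_ ?_, ?_, ?_⟩, ?_⟩
    · simp only [Finset.image_image]
      intro y hy
      obtain ⟨x, hx, rfl⟩ := Finset.mem_image.1 hy
      exact Finset.mem_image.2 ⟨_, (hg _ (hsnd x hx)).1, rfl⟩
    · simpa using nonempty_of_mem hτ.1
    · convert hκ' using 1
      simp only [κ, Finset.image_image]
      rfl
    · simp only [Finset.forall_mem_image]
      intro x hx y hy
      rcases hτ.2.2 x hx y hy with h | h
      · have := (hg _ (hsnd x hx)).2.2 _ (hsnd y hy) h.2
        exact Or.inl ⟨this.1, precEq_insertAt h.1 this.2 1⟩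
      · have := (hg _ (hsnd y hy)).2.2 _ (hsnd x hx) h.2
        exact Or.inr ⟨this.1, precEq_insertAt h.1 this.2 1⟩
    · rw [Finset.image_image]
      refine Finset.image_congr fun x hx => ?_
      have hx' := hg _ (hsnd x hx)
      have l₁ := length_of_mem hρ.2.1 _ (Finset.mem_image_of_mem Prod.snd hx'.1)
      have l₂ := length_of_mem hτ.1 _ (Finset.mem_image_of_mem Prod.fst hx)
      simp only [Function.comp, iota]
      rw [← l₂, ← insertAt_insertAt_left _ _ _ le_rfl (by omega) (by omega)]
      exact congrArg (fun y => insertAt x.1 y 1) hx'.2.1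
  set ξ : Bracketing × Bracketing := (leftComb a, leftComb b) with hξ
  have hιξ : iota 1 ξ = leftComb (a + b - 1) := insertAt_leftComb (by omega) (by omega)
  have hσe : σ.image (iota 1) ⊆ insert (leftComb (a + b - 1)) ((σ.erase ξ).image (iota 1)) := by
    rw [← hιξ, ← Finset.image_insert]
    exact Finset.image_subset_image (Finset.insert_erase_subset ξ σ)
  have hne : (σ.image (iota 1)).Nonempty := by simpa using nonempty_of_mem hσ.1
  rcases (σ.erase ξ).eq_empty_or_nonempty with he | he
  · refine triangulation_mono (mem_triangulation.2 ⟨by omega, Or.inl rfl⟩) ?_ hne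
    simpa [he] using hσe
  · have hτ := ((orderedProd (triangulation a) (triangulation b)).isRelLowerSet_faces hσ).2
      (Finset.erase_subset ξ σ) he
    change σ.erase ξ ∈ orderedProd (triangulation a) (triangulation b) at hτ
    suffices h : IsBaseFace (a + b - 1) ((σ.erase ξ).image (iota 1)) from
      triangulation_mono h.insert_mem hσe hne
    -- If both apexes occurred as coordinates, say of `x` and `y`, comparability and minimality
    -- would force the smaller of the two points to be the erased pair `ξ`.
    by_cases h₁ : leftComb a ∈ (σ.erase ξ).image Prod.fst
    · refine right _ hτ fun h₂ => ?_
      obtain ⟨x, hx, hxa⟩ := Finset.mem_image.1 h₁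
      obtain ⟨y, hy, hyb⟩ := Finset.mem_image.1 h₂
      have lx := length_of_mem hτ.2.1 _ (Finset.mem_image_of_mem Prod.snd hx)
      have ly := length_of_mem hτ.1 _ (Finset.mem_image_of_mem Prod.fst hy)
      have mx := leftComb_precEq x.2
      have my := leftComb_precEq y.1
      rw [lx, ← hyb] at mx
      rw [ly, ← hxa] at my
      rcases hτ.2.2 x hx y hy with h | h
      · exact (Finset.mem_erase.1 hx).1 (Prod.ext hxa ((h.2.antisymm mx).trans hyb))
      · exact (Finset.mem_erase.1 hy).1 (Prod.ext ((h.1.antisymm my).trans hxa) hyb)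
    · exact left _ hτ h₁

/-- `ι_t(T_a × T_b) ⊆ T_{a+b-1}` for all places `t` of `b`. -/
theorem image_iota_mem {a b t : ℕ} (ht : 1 ≤ t) (htb : t ≤ b)
    {σ : Finset (Bracketing × Bracketing)}
    (hσ : σ ∈ orderedProd (triangulation a) (triangulation b)) :
    σ.image (iota t) ∈ triangulation (a + b - 1) := by
  rcases ht.eq_or_lt with rfl | ht
  · exact image_iota_one_mem hσ
  · exact (image_iota_mem_of_two_le ht htb hσ).mem

/-! ### Signed shuffle calculus on abstract sequences -/

section Shuffles

variable (k : Type*) [CommRing k] {V W U Z V' W' : Type*}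

/-! ### Chains of finite sequences -/

/-- Prepending a vertex to all sequences of a chain. -/
def consChain (x : V) : Seqs k V →ₗ[k] Seqs k V := Finsupp.lmapDomain k k (List.cons x)

@[simp] theorem consChain_single (x : V) (l : List V) (c : k) :
    consChain k x (Finsupp.single l c) = Finsupp.single (x :: l) c :=
  Finsupp.mapDomain_single

/-- The coefficient of the empty sequence. -/
def nilCoeff : Seqs k V →ₗ[k] k := Finsupp.lapply []

theorem nilCoeff_single_nil (c : k) : nilCoeff k (Finsupp.single ([] : List V) c) = c := by
  simp [nilCoeff]

@[simp] theorem nilCoeff_single_cons (x : V) (l : List V) (c : k) :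
    nilCoeff k (Finsupp.single (x :: l) c) = 0 := by
  simp [nilCoeff]

/-- Two linear maps on chains agree as soon as they agree on all sequences. -/
theorem seqs_ext {M : Type*} [AddCommMonoid M] [Module k M] {f g : Seqs k V →ₗ[k] M}
    (h : ∀ l, f (Finsupp.single l 1) = g (Finsupp.single l 1)) (x : Seqs k V) : f x = g x := by
  have : f = g := Finsupp.lhom_ext' fun l => LinearMap.ext_ring (h l)
  rw [this]

@[simp] theorem nilCoeff_consChain (x : V) (z : Seqs k V) : nilCoeff k (consChain k x z) = 0 :=
  seqs_ext k (f := nilCoeff k ∘ₗ consChain k x) (g := 0) (by simp) z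

/-- Discarding the empty sequence. -/
def dropNil : Seqs k V →ₗ[k] Seqs k V :=
  Finsupp.linearCombination k fun l => if l = [] then 0 else Finsupp.single l 1

@[simp] theorem dropNil_single_nil (c : k) :
    dropNil k (Finsupp.single ([] : List V) c) = 0 := by
  simp [dropNil]

theorem dropNil_single {l : List V} (hl : l ≠ []) (c : k) :
    dropNil k (Finsupp.single l c) = Finsupp.single l c := by
  simp [dropNil, hl]

@[simp] theorem dropNil_consChain (x : V) (z : Seqs k V) :
    dropNil k (consChain k x z) = consChain k x z :=
  seqs_ext k (f := dropNil k ∘ₗ consChain k x) (g := consChain k x)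
    (fun l => by simp [dropNil_single]) z

/-- The sign `(-1)^m` on sequences of `m` vertices. -/
def signChain : Seqs k V →ₗ[k] Seqs k V :=
  Finsupp.linearCombination k fun l => Finsupp.single l ((-1) ^ l.length)

@[simp] theorem signChain_single (l : List V) (c : k) :
    signChain k (Finsupp.single l c) = (-1 : k) ^ l.length • Finsupp.single l c := by
  simp [signChain, mul_comm]

@[simp] theorem signChain_consChain (x : V) (z : Seqs k V) :
    signChain k (consChain k x z) = -consChain k x (signChain k z) :=
  seqs_ext k (f := signChain k ∘ₗ consChain k x) (g := -(consChain k x ∘ₗ signChain k))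
    (fun l => by simp [pow_succ]) z

/-! ### The augmented differential -/

/-- The augmented differential on one sequence, where `[v₀] ↦ []`. -/
def augBoundaryList : List V → Seqs k V
  | [] => 0
  | x :: l => Finsupp.single l 1 - consChain k x (augBoundaryList l)

@[simp] theorem augBoundaryList_nil : augBoundaryList k ([] : List V) = 0 := rfl

/-- The augmented differential. -/
def augBoundary : Seqs k V →ₗ[k] Seqs k V := Finsupp.linearCombination k (augBoundaryList k)

@[simp] theorem augBoundary_single (l : List V) :
    augBoundary k (Finsupp.single l 1) = augBoundaryList k l := by
  simp [augBoundary]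

@[simp] theorem augBoundary_single_nil (c : k) :
    augBoundary k (Finsupp.single ([] : List V) c) = 0 := by
  simp [augBoundary, augBoundaryList]

/-- Deleting the front vertex leaves `z`; every other deletion has its index raised by one, whence
the minus sign. -/
theorem augBoundary_consChain (x : V) (z : Seqs k V) :
    augBoundary k (consChain k x z) = z - consChain k x (augBoundary k z) :=
  seqs_ext k (f := augBoundary k ∘ₗ consChain k x)
    (g := LinearMap.id - consChain k x ∘ₗ augBoundary k)
    (fun l => by simp [augBoundaryList]) z

theorem augBoundaryList_eq_sum (l : List V) : augBoundaryList k l =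
    ∑ i ∈ Finset.range l.length, Finsupp.single (l.eraseIdx i) ((-1 : k) ^ i) := by
  induction l with
  | nil => simp [augBoundaryList]
  | cons x l ih =>
    rw [augBoundaryList, ih, List.length_cons, Finset.sum_range_succ', map_sum]
    simp [pow_succ, sub_eq_neg_add]

theorem nilCoeff_augBoundary_consChain (x : V) (z : Seqs k V) :
    nilCoeff k (augBoundary k (consChain k x z)) = nilCoeff k z := by
  rw [augBoundary_consChain, map_sub, nilCoeff_consChain, sub_zero]

/-- The two differentials differ only on one-vertex sequences, where the augmented one yields the
empty sequence. -/
theorem boundary_eq (x : Seqs k V) : boundary k V x = dropNil k (augBoundary k x) := by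
  refine seqs_ext k (f := boundary k V) (g := dropNil k ∘ₗ augBoundary k) (fun l => ?_) x
  simp only [boundary, Finsupp.linearCombination_single, one_smul, LinearMap.comp_apply,
    augBoundary_single]
  match l with
  | [] => simp [augBoundaryList]
  | [x] => simp [augBoundaryList]
  | x :: y :: l =>
    rw [if_neg (by simp), ← augBoundaryList_eq_sum, augBoundaryList, map_sub, dropNil_consChain,
      dropNil_single k (by simp)]

theorem augBoundary_dropNil (x : Seqs k V) : augBoundary k (dropNil k x) = augBoundary k x := by
  refine seqs_ext k (f := augBoundary k ∘ₗ dropNil k) (g := augBoundary k) (fun l => ?_) x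
  cases l with
  | nil => simp
  | cons x l => simp [dropNil_single]

theorem augBoundary_augBoundary (x : Seqs k V) : augBoundary k (augBoundary k x) = 0 := by
  refine seqs_ext k (f := augBoundary k ∘ₗ augBoundary k) (g := 0) (fun l => ?_) x
  induction l with
  | nil => simp
  | cons x l ih =>
    rw [LinearMap.comp_apply, LinearMap.zero_apply, augBoundary_single] at ih
    simp [augBoundaryList, augBoundary_consChain, ih]

theorem boundary_boundary (x : Seqs k V) : boundary k V (boundary k V x) = 0 := by
  rw [boundary_eq, boundary_eq, augBoundary_dropNil, augBoundary_augBoundary, map_zero]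

theorem signChain_augBoundary (x : Seqs k V) :
    signChain k (augBoundary k x) = -augBoundary k (signChain k x) := by
  refine seqs_ext k (f := signChain k ∘ₗ augBoundary k) (g := -(augBoundary k ∘ₗ signChain k))
    (fun l => ?_) x
  induction l with
  | nil => simp
  | cons x l ih =>
    simp only [LinearMap.comp_apply, LinearMap.neg_apply, augBoundary_single, signChain_single,
      map_smul] at ih ⊢
    simp only [augBoundaryList, map_sub, signChain_single, signChain_consChain, ih,
      List.length_cons, pow_succ, map_neg, map_smul]
    module

/-! ### The induced maps -/

@[simp] theorem pushforward_single (f : V → W) (l : List V) (c : k) :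
    pushforward k f (Finsupp.single l c) = Finsupp.single (l.map f) c :=
  Finsupp.mapDomain_single

@[simp] theorem pushforward_consChain (f : V → W) (x : V) (z : Seqs k V) :
    pushforward k f (consChain k x z) = consChain k (f x) (pushforward k f z) :=
  seqs_ext k (f := pushforward k f ∘ₗ consChain k x) (g := consChain k (f x) ∘ₗ pushforward k f)
    (by simp) z

theorem pushforward_pushforward (f : V → W) (g : W → U) (z : Seqs k V) :
    pushforward k g (pushforward k f z) = pushforward k (g ∘ f) z :=
  seqs_ext k (f := pushforward k g ∘ₗ pushforward k f) (g := pushforward k (g ∘ f)) (by simp) z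

theorem dropNil_pushforward (f : V → W) (z : Seqs k V) :
    dropNil k (pushforward k f z) = pushforward k f (dropNil k z) := by
  refine seqs_ext k (f := dropNil k ∘ₗ pushforward k f) (g := pushforward k f ∘ₗ dropNil k)
    (fun l => ?_) z
  cases l <;> simp [dropNil_single]

theorem augBoundary_pushforward (f : V → W) (z : Seqs k V) :
    augBoundary k (pushforward k f z) = pushforward k f (augBoundary k z) := by
  refine seqs_ext k (f := augBoundary k ∘ₗ pushforward k f)
    (g := pushforward k f ∘ₗ augBoundary k) (fun l => ?_) z
  induction l with
  | nil => simp
  | cons x l ih =>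
    simp only [LinearMap.comp_apply, pushforward_single, augBoundary_single] at ih ⊢
    simp [augBoundaryList, ih]

theorem boundary_pushforward (f : V → W) (z : Seqs k V) :
    boundary k W (pushforward k f z) = pushforward k f (boundary k V z) := by
  rw [boundary_eq, boundary_eq, augBoundary_pushforward, dropNil_pushforward]

/-! ### The cross product by recursion -/

/-- The cross product of two sequences, by recursion on the first step of the shuffle. It is `0` if
one of the sequences is empty. -/
def shuffleList : List V → List W → Seqs k (V × W)
  | [], _ => 0
  | _ :: _, [] => 0
  -- The scalar term ends the path and survives only when both tails are empty. A first step in the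
  -- second factor is overtaken by all `v.length` steps of the first, which is the number of
  -- inversions it creates.
  | a :: v, b :: w => consChain k (a, b)
      ((nilCoeff k (Finsupp.single v 1) * nilCoeff k (Finsupp.single w 1)) • Finsupp.single [] 1 +
        shuffleList v (b :: w) + (-1 : k) ^ v.length • shuffleList (a :: v) w)
termination_by v w => v.length + w.length

/-- The bilinear extension of `shuffleList`. -/
def shuffle : Seqs k V →ₗ[k] Seqs k W →ₗ[k] Seqs k (V × W) :=
  Finsupp.linearCombination k fun v => Finsupp.linearCombination k fun w => shuffleList k v w

@[simp] theorem shuffleList_nil_left (w : List W) : shuffleList k ([] : List V) w = 0 := by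
  simp [shuffleList]

@[simp] theorem shuffleList_nil_right (v : List V) : shuffleList k v ([] : List W) = 0 := by
  cases v <;> simp [shuffleList]

theorem shuffle_single (v : List V) (w : List W) (c d : k) :
    shuffle k (Finsupp.single v c) (Finsupp.single w d) = (c * d) • shuffleList k v w := by
  simp [shuffle, mul_smul]

theorem seqs_ext₂ {M : Type*} [AddCommMonoid M] [Module k M]
    {f g : Seqs k V →ₗ[k] Seqs k W →ₗ[k] M}
    (h : ∀ v w, f (Finsupp.single v 1) (Finsupp.single w 1) =
      g (Finsupp.single v 1) (Finsupp.single w 1)) (x : Seqs k V) (y : Seqs k W) :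
    f x y = g x y := by
  rw [seqs_ext k (f := f) (g := g) fun v => LinearMap.ext (seqs_ext k (h v))]

@[simp] theorem shuffle_nil_left (c : k) (y : Seqs k W) :
    shuffle k (Finsupp.single ([] : List V) c) y = 0 :=
  seqs_ext k (f := shuffle k (Finsupp.single ([] : List V) c)) (g := 0)
    (by simp [shuffle_single]) y

@[simp] theorem shuffle_nil_right (c : k) (x : Seqs k V) :
    shuffle k x (Finsupp.single ([] : List W) c) = 0 :=
  seqs_ext k (f := (shuffle k).flip (Finsupp.single ([] : List W) c)) (g := 0)
    (by simp [shuffle_single]) x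

/-- For a general chain `x` the length-dependent sign of the recursion cannot be pulled out as a
scalar; `signChain` carries it. -/
theorem shuffle_consChain (a : V) (b : W) (x : Seqs k V) (y : Seqs k W) :
    shuffle k (consChain k a x) (consChain k b y) = consChain k (a, b)
      ((nilCoeff k x * nilCoeff k y) • Finsupp.single [] 1 + shuffle k x (consChain k b y) +
        shuffle k (consChain k a (signChain k x)) y) := by
  let n : Seqs k V →ₗ[k] Seqs k W →ₗ[k] Seqs k (V × W) :=
    ((LinearMap.mul k k).compl₁₂ (nilCoeff k) (nilCoeff k)).compr₂
      (LinearMap.toSpanSingleton k _ (Finsupp.single [] 1))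
  refine seqs_ext₂ k (f := (shuffle k).compl₁₂ (consChain k a) (consChain k b))
    (g := (n + (shuffle k).compl₂ (consChain k b) +
      (shuffle k) ∘ₗ consChain k a ∘ₗ signChain k).compr₂ (consChain k (a, b)))
    (fun v w => ?_) x y
  simp [n, shuffle_single, shuffleList]

theorem shuffle_single_cons (a : V) (b : W) (v : List V) (w : List W) :
    shuffle k (Finsupp.single (a :: v) 1) (Finsupp.single (b :: w) 1) = consChain k (a, b)
      ((nilCoeff k (Finsupp.single v 1) * nilCoeff k (Finsupp.single w 1)) • Finsupp.single [] 1 +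
        shuffle k (Finsupp.single v 1) (Finsupp.single (b :: w) 1) +
        (-1 : k) ^ v.length • shuffle k (Finsupp.single (a :: v) 1) (Finsupp.single w 1)) := by
  simp [shuffle_single, shuffleList]

/-- Induction over pairs of sequences which removes one leading vertex at a time. -/
theorem list_induction₂ {P : List V → List W → Prop} (nil_left : ∀ w, P [] w)
    (nil_right : ∀ v, P v [])
    (cons : ∀ a v b w, P v (b :: w) → P (a :: v) w → P (a :: v) (b :: w)) (v : List V)
    (w : List W) : P v w := by
  induction v generalizing w with
  | nil => exact nil_left w
  | cons a v ihv =>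
    induction w with
    | nil => exact nil_right _
    | cons b w ihw => exact cons a v b w (ihv _) ihw

theorem shuffle_eq_consChain_or (v : List V) (w : List W) :
    shuffle k (Finsupp.single v 1) (Finsupp.single w 1) = 0 ∨
      ∃ x z, shuffle k (Finsupp.single v 1) (Finsupp.single w 1) = consChain k x z := by
  match v, w with
  | [], w => simp
  | v, [] => simp
  | a :: v, b :: w => exact Or.inr ⟨_, _, shuffle_single_cons k a b v w⟩

@[simp] theorem nilCoeff_shuffle (x : Seqs k V) (y : Seqs k W) :
    nilCoeff k (shuffle k x y) = 0 := by
  refine seqs_ext₂ k (f := (shuffle k).compr₂ (nilCoeff k)) (g := 0) (fun v w => ?_) x y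
  rw [LinearMap.compr₂_apply]
  obtain h | ⟨x, z, h⟩ := shuffle_eq_consChain_or k v w <;> simp [h]

@[simp] theorem dropNil_shuffle (x : Seqs k V) (y : Seqs k W) :
    dropNil k (shuffle k x y) = shuffle k x y := by
  refine seqs_ext₂ k (f := (shuffle k).compr₂ (dropNil k)) (g := shuffle k) (fun v w => ?_) x y
  rw [LinearMap.compr₂_apply]
  obtain h | ⟨x, z, h⟩ := shuffle_eq_consChain_or k v w <;> simp [h]

theorem nilCoeff_mul_pow (l : List V) :
    (-1 : k) ^ l.length * nilCoeff k (Finsupp.single l 1) = nilCoeff k (Finsupp.single l 1) := by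
  cases l <;> simp

/-- For nonempty sequences, every path has `v.length + w.length - 1` vertices, hence the extra minus
sign. -/
theorem signChain_shuffle (v : List V) (w : List W) :
    signChain k (shuffle k (Finsupp.single v 1) (Finsupp.single w 1)) =
      -((-1 : k) ^ (v.length + w.length) • shuffle k (Finsupp.single v 1) (Finsupp.single w 1)) := by
  induction v, w using list_induction₂ with
  | nil_left => simp
  | nil_right => simp
  | cons a v b w ih₁ ih₂ =>
    have h : nilCoeff k (Finsupp.single v 1) * nilCoeff k (Finsupp.single w 1) =
        (-1 : k) ^ (v.length + w.length) *
          (nilCoeff k (Finsupp.single v 1) * nilCoeff k (Finsupp.single w 1)) := by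
      rw [pow_add, mul_mul_mul_comm, nilCoeff_mul_pow, nilCoeff_mul_pow]
    rw [shuffle_single_cons, signChain_consChain]
    simp only [map_add, map_smul, ih₁, ih₂, signChain_single, List.length_nil, pow_zero, one_smul]
    nth_rw 1 [h]
    simp only [List.length_cons, pow_add, pow_one, map_neg, map_smul]
    module

/-- In the induction, the two terms `v * w`, coming from the two orders of a step in each factor,
cancel: this is the face omitting the corner between them. The last summand is present only for two
single vertices, whose product has boundary `[]` while products with `[]` vanish. The sign is
`-(-1)^v.length = (-1)^p`, as the degree is `p = v.length - 1`. -/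
theorem augBoundary_shuffle (v : List V) (w : List W) :
    augBoundary k (shuffle k (Finsupp.single v 1) (Finsupp.single w 1)) =
      shuffle k (augBoundary k (Finsupp.single v 1)) (Finsupp.single w 1) -
      (-1 : k) ^ v.length • shuffle k (Finsupp.single v 1) (augBoundary k (Finsupp.single w 1)) +
      (nilCoeff k (augBoundary k (Finsupp.single v 1)) *
        nilCoeff k (augBoundary k (Finsupp.single w 1))) • Finsupp.single [] 1 := by
  induction v, w using list_induction₂ with
  | nil_left => simp
  | nil_right => simp
  | cons a v b w ih₁ ih₂ =>
    have hs : signChain k (augBoundary k (Finsupp.single v 1)) =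
        -((-1 : k) ^ v.length • augBoundary k (Finsupp.single v 1)) := by
      rw [signChain_augBoundary, signChain_single, map_smul]
    have hv : Finsupp.single (a :: v) (1 : k) = consChain k a (Finsupp.single v 1) := by simp
    have hw : Finsupp.single (b :: w) (1 : k) = consChain k b (Finsupp.single w 1) := by simp
    have e₁ := shuffle_consChain k a b (augBoundary k (Finsupp.single v 1)) (Finsupp.single w 1)
    have e₂ := shuffle_consChain k a b (Finsupp.single v 1) (augBoundary k (Finsupp.single w 1))
    rw [hs] at e₁
    rw [signChain_single] at e₂
    rw [shuffle_single_cons, augBoundary_consChain]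
    simp only [map_add, map_smul, ih₁, ih₂, augBoundary_single_nil, map_zero, smul_zero]
    simp only [map_add, map_smul, hv, hw, nilCoeff_augBoundary_consChain] at e₁ e₂ ⊢
    simp only [augBoundary_consChain, map_sub, map_smul, map_neg, LinearMap.sub_apply,
      LinearMap.neg_apply, LinearMap.smul_apply, List.length_cons, e₁, e₂]
    rcases neg_one_pow_eq_or k v.length with h | h <;> rw [pow_succ, h] <;> module

theorem boundary_shuffle (v : List V) (w : List W) :
    boundary k (V × W) (shuffle k (Finsupp.single v 1) (Finsupp.single w 1)) =
      shuffle k (augBoundary k (Finsupp.single v 1)) (Finsupp.single w 1) -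
      (-1 : k) ^ v.length •
        shuffle k (Finsupp.single v 1) (augBoundary k (Finsupp.single w 1)) := by
  rw [boundary_eq, augBoundary_shuffle]
  simp only [map_add, map_sub, map_smul, dropNil_shuffle, dropNil_single_nil, smul_zero,
    add_zero]

theorem shuffle_pushforward (f : V → V') (g : W → W') (x : Seqs k V) (y : Seqs k W) :
    shuffle k (pushforward k f x) (pushforward k g y) =
      pushforward k (Prod.map f g) (shuffle k x y) := by
  refine seqs_ext₂ k (f := (shuffle k).compl₁₂ (pushforward k f) (pushforward k g))
    (g := (shuffle k).compr₂ (pushforward k (Prod.map f g))) (fun v w => ?_) x y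
  simp only [LinearMap.compl₁₂_apply, LinearMap.compr₂_apply, pushforward_single]
  induction v, w using list_induction₂ with
  | nil_left => simp
  | nil_right => simp
  | cons a v b w ih₁ ih₂ =>
    simp only [List.map_cons] at ih₁ ih₂ ⊢
    have h₁ : nilCoeff k (Finsupp.single (v.map f) 1) = nilCoeff k (Finsupp.single v 1) := by
      cases v <;> simp [nilCoeff]
    have h₂ : nilCoeff k (Finsupp.single (w.map g) 1) = nilCoeff k (Finsupp.single w 1) := by
      cases w <;> simp [nilCoeff]
    rw [shuffle_single_cons, shuffle_single_cons, ih₁, ih₂, pushforward_consChain, h₁, h₂]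
    simp only [map_add, map_smul, pushforward_single, List.map_nil, List.length_map,
      Prod.map_apply]

/-! ### Triple products -/

/-- The first step of a path in a triple product advances one of three coordinates, with a sign
counting the remaining steps in the earlier coordinates. Both ways of associating the product
satisfy this recursion. -/
theorem shuffle_shuffle_right_cons (a : V) (b : W) (c : U) (v : List V) (w : List W) (u : List U) :
    shuffle k (Finsupp.single (a :: v) 1)
        (shuffle k (Finsupp.single (b :: w) 1) (Finsupp.single (c :: u) 1)) =
      consChain k (a, b, c)
        ((nilCoeff k (Finsupp.single v 1) * nilCoeff k (Finsupp.single w 1) *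
            nilCoeff k (Finsupp.single u 1)) • Finsupp.single [] 1 +
          shuffle k (Finsupp.single v 1)
            (shuffle k (Finsupp.single (b :: w) 1) (Finsupp.single (c :: u) 1)) +
          (-1 : k) ^ v.length • shuffle k (Finsupp.single (a :: v) 1)
            (shuffle k (Finsupp.single w 1) (Finsupp.single (c :: u) 1)) +
          ((-1 : k) ^ v.length * (-1 : k) ^ w.length) • shuffle k (Finsupp.single (a :: v) 1)
            (shuffle k (Finsupp.single (b :: w) 1) (Finsupp.single u 1))) := by
  conv_lhs => rw [shuffle_single_cons, ← consChain_single, shuffle_consChain,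
    ← shuffle_single_cons]
  simp only [map_add, map_smul, nilCoeff_single_nil, nilCoeff_shuffle, smul_eq_mul,
    signChain_single, LinearMap.smul_apply, shuffle_nil_right, consChain_single, map_zero, smul_zero]
  module

theorem shuffle_shuffle_left_cons (a : V) (b : W) (c : U) (v : List V) (w : List W) (u : List U) :
    shuffle k (shuffle k (Finsupp.single (a :: v) 1) (Finsupp.single (b :: w) 1))
        (Finsupp.single (c :: u) 1) =
      consChain k ((a, b), c)
        ((nilCoeff k (Finsupp.single v 1) * nilCoeff k (Finsupp.single w 1) *
            nilCoeff k (Finsupp.single u 1)) • Finsupp.single [] 1 +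
          shuffle k (shuffle k (Finsupp.single v 1) (Finsupp.single (b :: w) 1))
            (Finsupp.single (c :: u) 1) +
          (-1 : k) ^ v.length • shuffle k
            (shuffle k (Finsupp.single (a :: v) 1) (Finsupp.single w 1))
            (Finsupp.single (c :: u) 1) +
          ((-1 : k) ^ v.length * (-1 : k) ^ w.length) • shuffle k
            (shuffle k (Finsupp.single (a :: v) 1) (Finsupp.single (b :: w) 1))
            (Finsupp.single u 1)) := by
  set Y : Seqs k (V × W) :=
    (nilCoeff k (Finsupp.single v 1) * nilCoeff k (Finsupp.single w 1)) • Finsupp.single [] 1 +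
      shuffle k (Finsupp.single v 1) (Finsupp.single (b :: w) 1) +
      (-1 : k) ^ v.length • shuffle k (Finsupp.single (a :: v) 1) (Finsupp.single w 1) with hY
  have hXY : shuffle k (Finsupp.single (a :: v) 1) (Finsupp.single (b :: w) 1) =
      consChain k (a, b) Y := shuffle_single_cons k a b v w
  have h : nilCoeff k (Finsupp.single v 1) * nilCoeff k (Finsupp.single w 1) =
      (-1 : k) ^ v.length * (-1 : k) ^ w.length *
        (nilCoeff k (Finsupp.single v 1) * nilCoeff k (Finsupp.single w 1)) := by
    rw [mul_mul_mul_comm, nilCoeff_mul_pow, nilCoeff_mul_pow]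
  -- All sequences in `Y` are tails of paths, with `v.length + w.length` vertices.
  have hs : signChain k Y = ((-1 : k) ^ v.length * (-1 : k) ^ w.length) • Y := by
    simp only [hY, map_add, map_smul, signChain_single, signChain_shuffle, List.length_nil,
      List.length_cons, pow_zero, one_smul]
    nth_rw 1 [h]
    simp only [pow_add, pow_one]
    module
  have hn : nilCoeff k Y = nilCoeff k (Finsupp.single v 1) * nilCoeff k (Finsupp.single w 1) := by
    simp only [hY, map_add, map_smul, nilCoeff_shuffle, nilCoeff_single_nil, smul_eq_mul]
    ring
  have hc : Finsupp.single (c :: u) (1 : k) = consChain k c (Finsupp.single u 1) := by simp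
  rw [hXY, hc, shuffle_consChain, ← hc, hs, hn]
  have hX : shuffle k Y (Finsupp.single (c :: u) 1) =
      shuffle k (shuffle k (Finsupp.single v 1) (Finsupp.single (b :: w) 1))
        (Finsupp.single (c :: u) 1) +
      (-1 : k) ^ v.length • shuffle k
        (shuffle k (Finsupp.single (a :: v) 1) (Finsupp.single w 1))
        (Finsupp.single (c :: u) 1) := by
    simp only [hY, map_add, map_smul, LinearMap.add_apply, LinearMap.smul_apply, shuffle_nil_left,
      smul_zero, zero_add]
  rw [hX]
  simp only [map_add, map_smul, LinearMap.smul_apply]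
  module

/-- Both sides obey the same recursion on the first step. Agreement is required only on occurring
vertices, since the insertion identities depend on lengths. -/
theorem pushforward_shuffle_assoc (f : V × W × U → Z) (g : (V × W) × U → Z) (v : List V)
    (w : List W) (u : List U) (h : ∀ a ∈ v, ∀ b ∈ w, ∀ c ∈ u, f (a, b, c) = g ((a, b), c)) :
    pushforward k f (shuffle k (Finsupp.single v 1)
        (shuffle k (Finsupp.single w 1) (Finsupp.single u 1))) =
      pushforward k g (shuffle k (shuffle k (Finsupp.single v 1) (Finsupp.single w 1))
        (Finsupp.single u 1)) := by
  induction v generalizing w u with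
  | nil => simp
  | cons a v ihv =>
  induction w generalizing u with
  | nil => simp
  | cons b w ihw =>
  induction u with
  | nil => simp
  | cons c u ihu =>
    rw [shuffle_shuffle_right_cons, shuffle_shuffle_left_cons]
    simp only [pushforward_consChain, map_add, map_smul]
    rw [ihv _ _ fun x hx y hy z hz => h x (List.mem_cons_of_mem _ hx) y hy z hz,
      ihw _ fun x hx y hy z hz => h x hx y (List.mem_cons_of_mem _ hy) z hz,
      ihu fun x hx y hy z hz => h x hx y hy z (List.mem_cons_of_mem _ hz),
      h a List.mem_cons_self b List.mem_cons_self c List.mem_cons_self]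
    simp

/-- Exchanging the first two coordinates permutes the terms of the recursion. The exponent has the
parity of the product of the degrees `v.length - 1` and `w.length - 1`. -/
theorem pushforward_shuffle_comm (f : V × W × U → Z) (g : W × V × U → Z) (v : List V)
    (w : List W) (u : List U) (h : ∀ a ∈ v, ∀ b ∈ w, ∀ c ∈ u, f (a, b, c) = g (b, a, c)) :
    pushforward k f (shuffle k (Finsupp.single v 1)
        (shuffle k (Finsupp.single w 1) (Finsupp.single u 1))) =
      (-1 : k) ^ ((v.length + 1) * (w.length + 1)) •
        pushforward k g (shuffle k (Finsupp.single w 1)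
          (shuffle k (Finsupp.single v 1) (Finsupp.single u 1))) := by
  induction v generalizing w u with
  | nil => simp
  | cons a v ihv =>
  induction w generalizing u with
  | nil => simp
  | cons b w ihw =>
  induction u with
  | nil => simp
  | cons c u ihu =>
    rw [shuffle_shuffle_right_cons, shuffle_shuffle_right_cons]
    simp only [pushforward_consChain, map_add, map_smul]
    rw [ihv _ _ fun x hx y hy z hz => h x (List.mem_cons_of_mem _ hx) y hy z hz,
      ihw _ fun x hx y hy z hz => h x hx y (List.mem_cons_of_mem _ hy) z hz,
      ihu fun x hx y hy z hz => h x hx y hy z (List.mem_cons_of_mem _ hz),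
      h a List.mem_cons_self b List.mem_cons_self c List.mem_cons_self,
      mul_comm (nilCoeff k (Finsupp.single v 1))]
    have hp (m n : ℕ) : (-1 : k) ^ ((m + 1 + 1) * (n + 1 + 1)) = (-1) ^ (m * n) :=
      neg_one_pow_congr (by simp only [Nat.even_mul, Nat.even_add_one]; tauto)
    have hp₁ (m n : ℕ) : (-1 : k) ^ ((m + 1) * (n + 1 + 1)) = (-1) ^ (m * n) * (-1) ^ n := by
      rw [← pow_add]
      exact neg_one_pow_congr (by simp only [Nat.even_mul, Nat.even_add_one, Nat.even_add]; tauto)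
    have hp₂ (m n : ℕ) : (-1 : k) ^ ((m + 1 + 1) * (n + 1)) = (-1) ^ (m * n) * (-1) ^ m := by
      rw [← pow_add]
      exact neg_one_pow_congr (by simp only [Nat.even_mul, Nat.even_add_one, Nat.even_add]; tauto)
    -- The sign is harmless: either `v` is empty and the exponent is zero, or the coefficient
    -- vanishes.
    have hm : nilCoeff k (Finsupp.single w 1) * nilCoeff k (Finsupp.single v 1) =
        (-1 : k) ^ (v.length * w.length) *
          (nilCoeff k (Finsupp.single w 1) * nilCoeff k (Finsupp.single v 1)) := by
      cases v <;> simp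
    nth_rw 1 [hm]
    simp only [List.length_cons, hp, hp₁, hp₂, map_smul, pushforward_single, List.map_nil]
    rcases neg_one_pow_eq_or k v.length with h | h <;> rw [h] <;> module

end Shuffles

/-! ### Comparison of the recursion with the explicit shuffle sum -/

section CrossProduct

variable (k : Type*) [CommRing k] {V W : Type*}

/-! ### The cross product as a sum over shuffles -/

/-- The sequence `v_{φ(l)}`, `0 ≤ l ≤ m`, where `φ(l)` is the number of elements `≤ l` of `I`. -/
def stepPath (v : List V) (m : ℕ) (I : Finset ℕ) : List V :=
  (List.range (m + 1)).filterMap fun l => v[(I.filter fun i => i ≤ l).card]?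

theorem shufflePath_eq (v : List V) (w : List W) (m : ℕ) (I : Finset ℕ) :
    shufflePath v w m I = (stepPath v m I).zip (stepPath w m (Finset.Icc 1 m \ I)) := rfl

/-- The translate of a finite set of natural numbers by one. -/
def shift (K : Finset ℕ) : Finset ℕ := K.map (addRightEmbedding 1)

theorem mem_shift {K : Finset ℕ} {i : ℕ} : i ∈ shift K ↔ ∃ j ∈ K, j + 1 = i := by
  simp [shift]

theorem card_filter_shift (K : Finset ℕ) (l : ℕ) :
    ((shift K).filter fun i => i ≤ l + 1).card = (K.filter fun i => i ≤ l).card := by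
  simp [shift, Finset.filter_map]

theorem one_notMem_shift {K : Finset ℕ} (hK : 0 ∉ K) : 1 ∉ shift K := by
  simpa [mem_shift] using hK

theorem stepPath_succ (a : V) (v : List V) (m : ℕ) {I : Finset ℕ} (hI : 0 ∉ I) :
    stepPath (a :: v) (m + 1) I = a :: (List.range (m + 1)).filterMap fun l =>
      (a :: v)[(I.filter fun i => i ≤ l + 1).card]? := by
  have h : (I.filter fun i => i ≤ 0) = ∅ := by
    ext i
    simp only [Finset.mem_filter, Finset.notMem_empty, iff_false, not_and]
    rintro hi hi'
    obtain rfl : i = 0 := by omega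
    exact hI hi
  rw [stepPath, List.range_succ_eq_map, List.filterMap_cons, h, List.filterMap_map]
  rfl

/-- Here 1 is not in the set, so the first step repeats the vertex `a`; in `stepPath_insert_shift`
it moves on to `v`. -/
theorem stepPath_shift (a : V) (v : List V) (m : ℕ) (K : Finset ℕ) :
    stepPath (a :: v) (m + 1) (shift K) = a :: stepPath (a :: v) m K := by
  rw [stepPath_succ _ _ _ (by simp [mem_shift])]
  simp only [card_filter_shift, stepPath]

theorem stepPath_insert_shift (a : V) (v : List V) (m : ℕ) {K : Finset ℕ} (hK : 0 ∉ K) :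
    stepPath (a :: v) (m + 1) (insert 1 (shift K)) = a :: stepPath v m K := by
  rw [stepPath_succ _ _ _ (by simp [mem_shift])]
  have h (l : ℕ) : ((insert 1 (shift K)).filter fun i => i ≤ l + 1).card =
      (K.filter fun i => i ≤ l).card + 1 := by
    rw [Finset.filter_insert, if_pos (by omega), Finset.card_insert_of_notMem
      (fun h => one_notMem_shift hK (Finset.mem_filter.1 h).1), card_filter_shift]
  simp only [h, List.getElem?_cons_succ, stepPath]

theorem Icc_succ_eq (m : ℕ) :
    Finset.Icc 1 (m + 1) = insert 1 (shift (Finset.Icc 1 m)) := by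
  ext i
  simp only [Finset.mem_Icc, Finset.mem_insert, mem_shift]
  constructor
  · intro h
    by_cases hi : i = 1
    · exact Or.inl hi
    · exact Or.inr ⟨i - 1, by omega, by omega⟩
  · rintro (rfl | ⟨j, hj, rfl⟩) <;> omega

theorem Icc_sdiff_shift (m : ℕ) {K : Finset ℕ} (hK : 0 ∉ K) :
    Finset.Icc 1 (m + 1) \ shift K = insert 1 (shift (Finset.Icc 1 m \ K)) := by
  rw [Icc_succ_eq, Finset.insert_sdiff_of_notMem _ (one_notMem_shift hK)]
  simp only [shift, Finset.map_sdiff]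

theorem Icc_sdiff_insert_shift (m : ℕ) (K : Finset ℕ) :
    Finset.Icc 1 (m + 1) \ insert 1 (shift K) = shift (Finset.Icc 1 m \ K) := by
  have h : 1 ∉ shift (Finset.Icc 1 m) := one_notMem_shift (by simp)
  rw [Icc_succ_eq, Finset.insert_sdiff_insert, Finset.sdiff_insert_of_notMem h]
  simp only [shift, Finset.map_sdiff]

/-- The number of inversions between two finite sets, as a double sum. -/
theorem card_inversions (I J : Finset ℕ) : ((I ×ˢ J).filter fun x => x.2 < x.1).card =
    ∑ i ∈ I, ∑ j ∈ J, if j < i then 1 else 0 := by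
  rw [Finset.card_filter, Finset.sum_product]

/-- The element 1 lies in the complement, below every element of the shifted set, and adds one
inversion for each of them. When 1 is in the set itself it adds none. -/
theorem shuffleSign_shift (m : ℕ) {K : Finset ℕ} (hK : 0 ∉ K) :
    shuffleSign k (m + 1) (shift K) = (-1) ^ K.card * shuffleSign k m K := by
  have h1 : (1 : ℕ) ∉ shift (Finset.Icc 1 m \ K) := one_notMem_shift (by simp)
  rw [shuffleSign, shuffleSign, Icc_sdiff_shift m hK, ← pow_add, card_inversions, card_inversions]
  congr 1
  simp only [Finset.sum_insert h1]
  simp only [shift, Finset.sum_map, addRightEmbedding_apply, add_lt_add_iff_right,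
    Finset.sum_add_distrib]
  congr 1
  rw [Finset.card_eq_sum_ones]
  refine Finset.sum_congr rfl fun i hi => if_pos ?_
  have : i ≠ 0 := fun h => hK (h ▸ hi)
  omega

theorem shuffleSign_insert_shift (m : ℕ) {K : Finset ℕ} (hK : 0 ∉ K) :
    shuffleSign k (m + 1) (insert 1 (shift K)) = shuffleSign k m K := by
  rw [shuffleSign, shuffleSign, Icc_sdiff_insert_shift m, card_inversions, card_inversions,
    Finset.sum_insert (one_notMem_shift hK)]
  have h : ∑ j ∈ shift (Finset.Icc 1 m \ K), (if j < 1 then 1 else 0) = 0 :=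
    Finset.sum_eq_zero fun j hj => by
      obtain ⟨i, -, rfl⟩ := mem_shift.1 hj
      simp
  rw [h, zero_add]
  simp only [shift, Finset.sum_map, addRightEmbedding_apply, add_lt_add_iff_right]

/-- The signed sum over the subsets `I` of `{1, …, m}` with `r` elements. -/
def shuffleSum (m r : ℕ) (v : List V) (w : List W) : Seqs k (V × W) :=
  ∑ I ∈ (Finset.Icc 1 m).powersetCard r,
    Finsupp.single (shufflePath v w m I) (shuffleSign k m I)

theorem zero_notMem_of_mem_powersetCard {m r : ℕ} {K : Finset ℕ}
    (hK : K ∈ (Finset.Icc 1 m).powersetCard r) : 0 ∉ K := fun h => by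
  simpa using (Finset.mem_powersetCard.1 hK).1 h

theorem sum_powersetCard_shift (m r : ℕ) (a : V) (b : W) (v : List V) (w : List W) :
    ∑ I ∈ (shift (Finset.Icc 1 m)).powersetCard r,
      Finsupp.single (shufflePath (a :: v) (b :: w) (m + 1) I) (shuffleSign k (m + 1) I) =
    (-1 : k) ^ r • consChain k (a, b) (shuffleSum k m r (a :: v) w) := by
  rw [shift, Finset.powersetCard_map, Finset.sum_map, shuffleSum, map_sum, Finset.smul_sum]
  refine Finset.sum_congr rfl fun K hK => ?_
  have h0 := zero_notMem_of_mem_powersetCard hK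
  change Finsupp.single (shufflePath (a :: v) (b :: w) (m + 1) (shift K))
    (shuffleSign k (m + 1) (shift K)) = _
  rw [shufflePath_eq, Icc_sdiff_shift m h0, stepPath_shift, stepPath_insert_shift _ _ _ (by simp),
    shuffleSign_shift k m h0, (Finset.mem_powersetCard.1 hK).2, consChain_single,
    Finsupp.smul_single, smul_eq_mul]
  rfl

theorem shuffleSum_succ_zero (m : ℕ) (a : V) (b : W) (v : List V) (w : List W) :
    shuffleSum k (m + 1) 0 (a :: v) (b :: w) =
      consChain k (a, b) (shuffleSum k m 0 (a :: v) w) := by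
  have h := sum_powersetCard_shift k m 0 a b v w
  rw [pow_zero, one_smul, Finset.powersetCard_zero] at h
  rw [← h, shuffleSum, Finset.powersetCard_zero]

/-- The subsets are split according to whether they contain 1, that is, by the first step of the
path. -/
theorem shuffleSum_succ_succ (m r : ℕ) (a : V) (b : W) (v : List V) (w : List W) :
    shuffleSum k (m + 1) (r + 1) (a :: v) (b :: w) =
      consChain k (a, b) (shuffleSum k m r v (b :: w)) +
      (-1 : k) ^ (r + 1) • consChain k (a, b) (shuffleSum k m (r + 1) (a :: v) w) := by
  have h1 : 1 ∉ shift (Finset.Icc 1 m) := one_notMem_shift (by simp)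
  have hmem : ∀ I ∈ (shift (Finset.Icc 1 m)).powersetCard r, 1 ∉ I := fun I hI h =>
    h1 ((Finset.mem_powersetCard.1 hI).1 h)
  rw [shuffleSum, Icc_succ_eq, Finset.powersetCard_succ_insert h1, Finset.sum_union,
    sum_powersetCard_shift, add_comm, Finset.sum_image]
  · congr 1
    rw [shift, Finset.powersetCard_map, Finset.sum_map, shuffleSum, map_sum]
    refine Finset.sum_congr rfl fun K hK => ?_
    have h0 := zero_notMem_of_mem_powersetCard hK
    change Finsupp.single (shufflePath (a :: v) (b :: w) (m + 1) (insert 1 (shift K)))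
      (shuffleSign k (m + 1) (insert 1 (shift K))) = _
    rw [shufflePath_eq, Icc_sdiff_insert_shift m, stepPath_shift, stepPath_insert_shift _ _ _ h0,
      shuffleSign_insert_shift k m h0, consChain_single]
    rfl
  · intro I hI J hJ hIJ
    rw [← Finset.erase_insert (hmem I hI), ← Finset.erase_insert (hmem J hJ)]
    exact congrArg (fun K => Finset.erase K 1) hIJ
  · refine Finset.disjoint_left.2 fun I hI hI' => h1 ?_
    obtain ⟨J, -, rfl⟩ := Finset.mem_image.1 hI'
    exact (Finset.mem_powersetCard.1 hI).1 (Finset.mem_insert_self 1 J)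

theorem shuffleSum_eq (a : V) (v : List V) (b : W) (w : List W) :
    shuffleSum k (v.length + w.length) v.length (a :: v) (b :: w) =
      shuffleList k (a :: v) (b :: w) := by
  match v, w with
  | [], [] =>
    rw [shuffleList]
    simp [shuffleSum, shufflePath, shuffleSign, nilCoeff]
  | [], b' :: w =>
    have ih := shuffleSum_eq a [] b' w
    simp only [List.length_nil, zero_add, List.length_cons] at ih ⊢
    rw [shuffleSum_succ_zero, ih]
    conv_rhs => rw [shuffleList]
    simp
  | a' :: v, [] =>
    have ih := shuffleSum_eq a' v b []
    simp only [List.length_nil, add_zero, List.length_cons] at ih ⊢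
    -- The second factor has no steps left: a set of `v.length` elements has no subset with one
    -- element more.
    have h : shuffleSum k v.length (v.length + 1) (a :: a' :: v) ([] : List W) = 0 := by
      rw [shuffleSum, Finset.powersetCard_eq_empty.2 (by simp), Finset.sum_empty]
    rw [shuffleSum_succ_succ, ih, h]
    conv_rhs => rw [shuffleList]
    simp
  | a' :: v, b' :: w =>
    have ih₁ := shuffleSum_eq a' v b (b' :: w)
    have ih₂ := shuffleSum_eq a (a' :: v) b' w
    simp only [List.length_cons] at ih₁ ih₂ ⊢
    rw [show v.length + 1 + (w.length + 1) = v.length + 1 + w.length + 1 by omega,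
      shuffleSum_succ_succ, ih₂,
      show v.length + 1 + w.length = v.length + (w.length + 1) by omega, ih₁]
    conv_rhs => rw [shuffleList]
    simp
termination_by v.length + w.length

/-- If one sequence is empty, `cross` returns the empty path while `shuffle` returns zero;
discarding empty sequences reconciles them. -/
theorem cross_dropNil (x : Seqs k V) (y : Seqs k W) :
    cross k V W (dropNil k x) (dropNil k y) = shuffle k x y := by
  refine seqs_ext₂ k (f := (cross k V W).compl₁₂ (dropNil k) (dropNil k)) (g := shuffle k)
    (fun v w => ?_) x y
  match v, w with
  | [], w => simp
  | v, [] => simp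
  | a :: v, b :: w =>
    rw [LinearMap.compl₁₂_apply, dropNil_single k (by simp), dropNil_single k (by simp),
      shuffle_single, ← shuffleSum_eq]
    simp [cross, crossSimplex, shuffleSum]

end CrossProduct

/-! ### Chains of the triangulations and the comp algebra laws -/

section CompAlgebra

variable (k : Type*) [CommRing k] {V W : Type*}

/-! ### The chains of the canonical triangulations -/

/-- The sequences of vertices which span `chains k p n`. -/
def IsSimplexSeq (p : ℤ) (n : ℕ) (l : List Bracketing) : Prop :=
  (l.length : ℤ) = p + 1 ∧ l.Pairwise Prec ∧ l.toFinset ∈ triangulation n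

theorem IsSimplexSeq.ne_nil {p : ℤ} {n : ℕ} {l : List Bracketing} (h : IsSimplexSeq p n l) :
    l ≠ [] := by
  rintro rfl
  exact Finset.not_nonempty_empty (nonempty_of_mem h.2.2)

theorem IsSimplexSeq.length_eq {p : ℤ} {n : ℕ} {l : List Bracketing} (h : IsSimplexSeq p n l)
    {u : Bracketing} (hu : u ∈ l) : u.length = n :=
  length_of_mem h.2.2 u (List.mem_toFinset.2 hu)

theorem mem_chains {p : ℤ} {n : ℕ} {s : Seqs k Bracketing} :
    s ∈ chains k p n ↔ s ∈ Finsupp.supported k k {l | IsSimplexSeq p n l} := Iff.rfl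

theorem single_mem_chains {p : ℤ} {n : ℕ} {l : List Bracketing} (h : IsSimplexSeq p n l) (c : k) :
    Finsupp.single l c ∈ chains k p n := Finsupp.single_mem_supported k c h

/-- A linear property of chains may be checked on simplices. -/
theorem chains_induction {k : Type*} [CommRing k] {p : ℤ} {n : ℕ}
    {P : (s : Seqs k Bracketing) → s ∈ chains k p n → Prop} (zero : P 0 (zero_mem _))
    (add : ∀ x y hx hy, P x hx → P y hy → P (x + y) (add_mem hx hy))
    (smul : ∀ (c : k) x hx, P x hx → P (c • x) (Submodule.smul_mem _ c hx))
    (single : ∀ l (hl : IsSimplexSeq p n l), P (Finsupp.single l 1) (single_mem_chains k hl 1))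
    {s : Seqs k Bracketing} (hs : s ∈ chains k p n) : P s hs := by
  suffices h : ∃ hs, P s hs from h.2
  rw [mem_chains, Finsupp.supported_eq_span_single] at hs
  induction hs using Submodule.span_induction with
  | mem x hx =>
    obtain ⟨l, hl, rfl⟩ := hx
    exact ⟨_, single l hl⟩
  | zero => exact ⟨_, zero⟩
  | add x y _ _ hx hy => exact ⟨_, add x y hx.1 hy.1 hx.2 hy.2⟩
  | smul c x _ hx => exact ⟨_, smul c x hx.1 hx.2⟩

theorem boundary_mem_chains {p : ℤ} {n : ℕ} {s : Seqs k Bracketing} (hs : s ∈ chains k p n) :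
    boundary k Bracketing s ∈ chains k (p - 1) n := by
  induction hs using chains_induction with
  | zero => simp
  | add x y _ _ hx hy =>
    rw [map_add]
    exact add_mem hx hy
  | smul c x _ hx =>
    rw [map_smul]
    exact Submodule.smul_mem _ c hx
  | single l hl =>
    rw [boundary, Finsupp.linearCombination_single, one_smul]
    split_ifs with h
    · exact zero_mem _
    refine sum_mem fun i hi => single_mem_chains k ⟨?_, ?_, ?_⟩ _
    · have h₁ := hl.1
      have h₂ := List.length_eraseIdx_add_one (Finset.mem_range.1 hi)
      omega
    · exact hl.2.1.sublist (List.eraseIdx_sublist l i)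
    · refine triangulation_mono hl.2.2 ?_ ?_
      · intro u hu
        rw [List.mem_toFinset] at hu ⊢
        exact (List.eraseIdx_sublist l i).subset hu
      · have h₂ := List.length_eraseIdx_add_one (Finset.mem_range.1 hi)
        rw [List.toFinset_nonempty_iff]
        intro h₃
        rw [h₃] at h₂
        simp at h₂
        omega

/-- The strict componentwise order on pairs. -/
def PairPrec (x y : Bracketing × Bracketing) : Prop :=
  (Prec x.1 y.1 ∧ PrecEq x.2 y.2) ∨ (PrecEq x.1 y.1 ∧ Prec x.2 y.2)

theorem PairPrec.iota {x y : Bracketing × Bracketing} (h : PairPrec x y) (t : ℕ) :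
    Prec (iota t x) (iota t y) := by
  rcases h with h | h
  · exact Relation.TransGen.trans_left (h.1.insertAt_left x.2 t)
      (precEq_insertAt (PrecEq.refl _) h.2 t)
  · exact Relation.TransGen.trans_right (precEq_insertAt h.1 (PrecEq.refl x.2) t)
      (h.2.insertAt_right y.1 t)

theorem PairPrec.precEq {x y : Bracketing × Bracketing} (h : PairPrec x y) :
    PrecEq x.1 y.1 ∧ PrecEq x.2 y.2 := by
  rcases h with h | h
  · exact ⟨h.1.precEq, h.2⟩
  · exact ⟨h.1, h.2.precEq⟩

/-- The sequences of pairs which occur in the cross product of `v` and `w`. -/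
def IsShufflePath (v w : List Bracketing) (l : List (Bracketing × Bracketing)) : Prop :=
  l.length + 1 = v.length + w.length ∧ (∀ x ∈ l, x.1 ∈ v ∧ x.2 ∈ w) ∧ l.Pairwise PairPrec

theorem consChain_mem_supported {x : V} {S T : Set (List V)} (h : ∀ l ∈ S, x :: l ∈ T)
    {z : Seqs k V} (hz : z ∈ Finsupp.supported k k S) :
    consChain k x z ∈ Finsupp.supported k k T := by
  rw [Finsupp.supported_eq_span_single] at hz
  induction hz using Submodule.span_induction with
  | mem z hz =>
    obtain ⟨l, hl, rfl⟩ := hz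
    rw [consChain_single]
    exact Finsupp.single_mem_supported k 1 (h l hl)
  | zero => simp
  | add x y _ _ hx hy =>
    rw [map_add]
    exact add_mem hx hy
  | smul c x _ hx =>
    rw [map_smul]
    exact Submodule.smul_mem _ c hx

/-- Each step advances one strictly increasing sequence and keeps the other in place, so paths
increase strictly. -/
theorem shuffleList_mem_supported (v w : List Bracketing) (hv : v.Pairwise Prec)
    (hw : w.Pairwise Prec) :
    shuffleList k v w ∈ Finsupp.supported k k {l | IsShufflePath v w l} := by
  induction v, w using list_induction₂ with
  | nil_left => simp
  | nil_right => simp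
  | cons a v b w ih₁ ih₂ =>
    have hv' := List.pairwise_cons.1 hv
    have hw' := List.pairwise_cons.1 hw
    have hb : ∀ y ∈ b :: w, PrecEq b y := fun y hy =>
      (List.mem_cons.1 hy).elim (fun h => h ▸ PrecEq.refl _) fun h => (hw'.1 y h).precEq
    have ha : ∀ y ∈ a :: v, PrecEq a y := fun y hy =>
      (List.mem_cons.1 hy).elim (fun h => h ▸ PrecEq.refl _) fun h => (hv'.1 y h).precEq
    rw [shuffleList, map_add, map_add, map_smul, map_smul]
    refine add_mem (add_mem ?_ ?_) (Submodule.smul_mem _ _ ?_)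
    · cases v with
      | cons => simp
      | nil =>
      cases w with
      | cons => simp
      | nil =>
      refine Submodule.smul_mem _ _ ?_
      rw [consChain_single]
      refine Finsupp.single_mem_supported k 1 ⟨by simp, by simp, by simp⟩
    · refine consChain_mem_supported k ?_ (ih₁ hv'.2 hw)
      rintro l ⟨h₁, h₂, h₃⟩
      refine ⟨by simp only [List.length_cons] at h₁ ⊢; omega, ?_, List.pairwise_cons.2 ⟨?_, h₃⟩⟩
      · rintro x hx
        rcases List.mem_cons.1 hx with rfl | hx
        · simp
        · exact ⟨List.mem_cons_of_mem _ (h₂ x hx).1, (h₂ x hx).2⟩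
      · exact fun x hx => Or.inl ⟨hv'.1 _ (h₂ x hx).1, hb _ (h₂ x hx).2⟩
    · refine consChain_mem_supported k ?_ (ih₂ hv hw'.2)
      rintro l ⟨h₁, h₂, h₃⟩
      refine ⟨by simp only [List.length_cons] at h₁ ⊢; omega, ?_, List.pairwise_cons.2 ⟨?_, h₃⟩⟩
      · rintro x hx
        rcases List.mem_cons.1 hx with rfl | hx
        · simp
        · exact ⟨(h₂ x hx).1, List.mem_cons_of_mem _ (h₂ x hx).2⟩
      · exact fun x hx => Or.inr ⟨ha _ (h₂ x hx).1, hw'.1 _ (h₂ x hx).2⟩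

/-- A path is a simplex of the ordered product, and `image_iota_mem` carries it into the
triangulation. -/
theorem IsShufflePath.isSimplexSeq {p q : ℤ} {a b t : ℕ} (ht : 1 ≤ t) (htb : t ≤ b)
    {v w : List Bracketing} (hv : IsSimplexSeq p a v) (hw : IsSimplexSeq q b w)
    {l : List (Bracketing × Bracketing)} (hl : IsShufflePath v w l) :
    IsSimplexSeq (p + q) (a + b - 1) (l.map (iota t)) := by
  have hlen := hl.1
  have hv₀ := List.length_pos_iff.2 hv.ne_nil
  have hw₀ := List.length_pos_iff.2 hw.ne_nil
  have hv₁ := hv.1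
  have hw₁ := hw.1
  have hne : l.toFinset.Nonempty := by
    rw [List.toFinset_nonempty_iff]
    rintro rfl
    simp at hlen
    omega
  refine ⟨by rw [List.length_map]; omega, ?_, ?_⟩
  · exact List.pairwise_map.2 (hl.2.2.imp fun h => h.iota t)
  · have h : l.toFinset ∈ orderedProd (triangulation a) (triangulation b) := by
      refine ⟨triangulation_mono hv.2.2 ?_ (hne.image _),
        triangulation_mono hw.2.2 ?_ (hne.image _), ?_⟩
      · intro u hu
        obtain ⟨x, hx, rfl⟩ := Finset.mem_image.1 hu
        exact List.mem_toFinset.2 (hl.2.1 x (List.mem_toFinset.1 hx)).1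
      · intro u hu
        obtain ⟨x, hx, rfl⟩ := Finset.mem_image.1 hu
        exact List.mem_toFinset.2 (hl.2.1 x (List.mem_toFinset.1 hx)).2
      · intro x hx y hy
        rw [List.mem_toFinset] at hx hy
        let R (x y : Bracketing × Bracketing) : Prop :=
          (PrecEq x.1 y.1 ∧ PrecEq x.2 y.2) ∨ (PrecEq y.1 x.1 ∧ PrecEq y.2 x.2)
        have : Std.Symm R := ⟨fun _ _ h => h.symm⟩
        exact List.Pairwise.forall_of_forall (R := R)
          (fun x _ => Or.inl ⟨PrecEq.refl _, PrecEq.refl _⟩)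
          (hl.2.2.imp fun h => Or.inl h.precEq) hx hy
    convert image_iota_mem ht htb h using 1
    ext u
    simp

theorem diamond_dropNil (t : ℕ) (x y : Seqs k Bracketing) :
    diamond k t (dropNil k x) (dropNil k y) = pushforward k (iota t) (shuffle k x y) := by
  rw [diamond, LinearMap.compr₂_apply, cross_dropNil]

theorem diamond_single (t : ℕ) {v w : List Bracketing} (hv : v ≠ []) (hw : w ≠ []) :
    diamond k t (Finsupp.single v 1) (Finsupp.single w 1) =
      pushforward k (iota t) (shuffle k (Finsupp.single v 1) (Finsupp.single w 1)) := by
  rw [← diamond_dropNil, dropNil_single k hv, dropNil_single k hw]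

theorem diamond_mem_chains {p q : ℤ} {a b t : ℕ} (ht : 1 ≤ t) (htb : t ≤ b)
    {s s' : Seqs k Bracketing} (hs : s ∈ chains k p a) (hs' : s' ∈ chains k q b) :
    diamond k t s s' ∈ chains k (p + q) (a + b - 1) := by
  induction hs using chains_induction with
  | zero => simp
  | add x y _ _ hx hy =>
    rw [map_add, LinearMap.add_apply]
    exact add_mem hx hy
  | smul c x _ hx =>
    rw [map_smul, LinearMap.smul_apply]
    exact Submodule.smul_mem _ c hx
  | single v hv =>
  induction hs' using chains_induction with
  | zero => simp
  | add x y _ _ hx hy =>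
    rw [map_add]
    exact add_mem hx hy
  | smul c x _ hx =>
    rw [map_smul]
    exact Submodule.smul_mem _ c hx
  | single w hw =>
    rw [diamond_single k t hv.ne_nil hw.ne_nil, shuffle_single, one_mul, one_smul]
    have h := shuffleList_mem_supported k v w hv.2.1 hw.2.1
    rw [Finsupp.supported_eq_span_single] at h
    generalize shuffleList k v w = y at h
    induction h using Submodule.span_induction with
    | mem z hz =>
      obtain ⟨l, hl, rfl⟩ := hz
      simp only [pushforward_single]
      exact single_mem_chains k (IsShufflePath.isSimplexSeq ht htb hv hw hl) 1
    | zero => simp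
    | add x y _ _ hx hy =>
      rw [map_add]
      exact add_mem hx hy
    | smul c x _ hx =>
      rw [map_smul]
      exact Submodule.smul_mem _ c hx

/-- A simplex determines its degree by its number of vertices and its arity by the length of any
vertex, so the spanning sets are disjoint. -/
theorem iSupIndep_chains : iSupIndep fun i : ℤ × ℕ => chains k i.1 i.2 := by
  intro i
  have h : ⨆ (j : ℤ × ℕ) (_ : j ≠ i), chains k j.1 j.2 ≤
      Finsupp.supported k k (⋃ (j : ℤ × ℕ) (_ : j ≠ i), {l | IsSimplexSeq j.1 j.2 l}) :=
    iSup₂_le fun j hj => Finsupp.supported_mono <|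
      Set.subset_iUnion₂ (s := fun (j : ℤ × ℕ) (_ : j ≠ i) => {l | IsSimplexSeq j.1 j.2 l}) j hj
  refine Disjoint.mono_right h
    (Finsupp.disjoint_supported_supported (s := {l | IsSimplexSeq i.1 i.2 l}) ?_)
  rw [Set.disjoint_left]
  intro l hl hl'
  simp only [Set.mem_iUnion] at hl'
  obtain ⟨j, hj, hlj⟩ := hl'
  obtain ⟨u, hu⟩ := List.exists_mem_of_ne_nil l hl.ne_nil
  refine hj (Prod.ext ?_ ((hlj.length_eq hu).symm.trans (hl.length_eq hu)))
  have h₁ := hl.1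
  have h₂ := hlj.1
  omega

/-! ### Signs -/

theorem negOnePow_smul {M : Type*} [AddCommGroup M] [Module k M] {i : ℤ} {n : ℕ}
    (h : Even i ↔ Even n) (x : M) : i.negOnePow • x = (-1 : k) ^ n • x := by
  rcases Nat.even_or_odd n with hn | hn
  · rw [Int.negOnePow_even i (h.2 hn), hn.neg_one_pow, one_smul, one_smul]
  · have hi : Odd i := by
      rw [← Int.not_even_iff_odd, h]
      exact Nat.not_even_iff_odd.2 hn
    rw [Int.negOnePow_odd i hi, hn.neg_one_pow, neg_smul, one_smul, Units.neg_smul, one_smul]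

theorem even_mul_iff {p q : ℤ} {m n : ℕ} (hm : (m : ℤ) = p + 1) (hn : (n : ℤ) = q + 1) :
    Even (p * q) ↔ Even ((m + 1) * (n + 1)) := by
  have h₁ : Even p ↔ Even (m + 1) := by
    rw [← Int.even_coe_nat, Nat.cast_add, hm]
    simp [add_assoc]
  have h₂ : Even q ↔ Even (n + 1) := by
    rw [← Int.even_coe_nat, Nat.cast_add, hn]
    simp [add_assoc]
  rw [Int.even_mul, Nat.even_mul, h₁, h₂]

/-! ### The laws of a differential comp algebra -/

/-- Three chains may be replaced by simplices in the proof of a trilinear identity. -/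
theorem chains_trilinear {p q r : ℤ} {a b c : ℕ} {M : Type*} [AddCommGroup M] [Module k M]
    (f g : Seqs k Bracketing →ₗ[k] Seqs k Bracketing →ₗ[k] Seqs k Bracketing →ₗ[k] M)
    (h : ∀ v w u, IsSimplexSeq p a v → IsSimplexSeq q b w → IsSimplexSeq r c u →
      f (Finsupp.single v 1) (Finsupp.single w 1) (Finsupp.single u 1) =
        g (Finsupp.single v 1) (Finsupp.single w 1) (Finsupp.single u 1))
    {s t u : Seqs k Bracketing} (hs : s ∈ chains k p a) (ht : t ∈ chains k q b)
    (hu : u ∈ chains k r c) : f s t u = g s t u := by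
  induction hs using chains_induction with
  | zero => simp
  | add x y _ _ hx hy => simp only [map_add, LinearMap.add_apply, hx, hy]
  | smul d x _ hx => simp only [map_smul, LinearMap.smul_apply, hx]
  | single v hv =>
  induction ht using chains_induction with
  | zero => simp
  | add x y _ _ hx hy => simp only [map_add, LinearMap.add_apply, hx, hy]
  | smul d x _ hx => simp only [map_smul, LinearMap.smul_apply, hx]
  | single w hw =>
  induction hu using chains_induction with
  | zero => simp
  | add x y _ _ hx hy => simp only [map_add, hx, hy]
  | smul d x _ hx => simp only [map_smul, hx]
  | single u hu => exact h v w u hv hw hu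

/-- The inner product contains no empty sequence, so `dropNil` may be inserted freely; naturality of
the shuffle for `id × ι_j` then moves both vertex maps outside. -/
theorem diamond_diamond_right_single (i j : ℕ) {v w u : List Bracketing} (hv : v ≠ [])
    (hw : w ≠ []) (hu : u ≠ []) :
    diamond k i (Finsupp.single v 1)
        (diamond k j (Finsupp.single w 1) (Finsupp.single u 1)) =
      pushforward k (fun x => insertAt x.1 (insertAt x.2.1 x.2.2 j) i)
        (shuffle k (Finsupp.single v 1)
          (shuffle k (Finsupp.single w 1) (Finsupp.single u 1))) := by
  have h : pushforward k id (Finsupp.single v (1 : k)) = Finsupp.single v 1 := by simp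
  rw [diamond_single k j hw hu, ← dropNil_shuffle, ← dropNil_pushforward, ← dropNil_single k hv,
    diamond_dropNil, dropNil_single k hv]
  conv_lhs => rw [← h, shuffle_pushforward, pushforward_pushforward]
  rw [dropNil_shuffle]
  rfl

theorem diamond_diamond_left_single (i j : ℕ) {v w u : List Bracketing} (hv : v ≠ [])
    (hw : w ≠ []) (hu : u ≠ []) :
    diamond k j (diamond k i (Finsupp.single v 1) (Finsupp.single w 1)) (Finsupp.single u 1) =
      pushforward k (fun x => insertAt (insertAt x.1.1 x.1.2 i) x.2 j)
        (shuffle k (shuffle k (Finsupp.single v 1) (Finsupp.single w 1))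
          (Finsupp.single u 1)) := by
  have h : pushforward k id (Finsupp.single u (1 : k)) = Finsupp.single u 1 := by simp
  rw [diamond_single k i hv hw, ← dropNil_shuffle, ← dropNil_pushforward, ← dropNil_single k hu,
    diamond_dropNil, dropNil_single k hu]
  conv_lhs => rw [← h, shuffle_pushforward, pushforward_pushforward]
  rw [dropNil_shuffle]
  rfl

/-- The trilinear map `(s, t, u) ↦ s ⋄_i (t ⋄_j u)`. -/
def diamondRight (i j : ℕ) : Seqs k Bracketing →ₗ[k] Seqs k Bracketing →ₗ[k]
    Seqs k Bracketing →ₗ[k] Seqs k Bracketing :=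
  LinearMap.mk₂ k (fun s t => diamond k i s ∘ₗ diamond k j t)
    (fun _ _ _ => LinearMap.ext fun _ => by simp) (fun _ _ _ => LinearMap.ext fun _ => by simp)
    (fun _ _ _ => LinearMap.ext fun _ => by simp) (fun _ _ _ => LinearMap.ext fun _ => by simp)

theorem diamondRight_apply (i j : ℕ) (s t u : Seqs k Bracketing) :
    diamondRight k i j s t u = diamond k i s (diamond k j t u) := rfl

theorem diamond_assoc_mid {p q r : ℤ} {a b c i j : ℕ} (hj : 1 ≤ j) (hjc : j ≤ c) (hji : j ≤ i)
    (hi : i ≤ b + j - 1) {s t u : Seqs k Bracketing} (hs : s ∈ chains k p a)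
    (ht : t ∈ chains k q b) (hu : u ∈ chains k r c) :
    diamond k i s (diamond k j t u) = diamond k j (diamond k (i - j + 1) s t) u := by
  have key := chains_trilinear k (diamondRight k i j)
    ((diamond k (i - j + 1)).compr₂ (diamond k j)) (fun v w x hv hw hx => ?_) hs ht hu
  · rwa [diamondRight_apply, LinearMap.compr₂_apply] at key
  rw [diamondRight_apply, LinearMap.compr₂_apply,
    diamond_diamond_right_single k i j hv.ne_nil hw.ne_nil hx.ne_nil,
    diamond_diamond_left_single k (i - j + 1) j hv.ne_nil hw.ne_nil hx.ne_nil]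
  refine pushforward_shuffle_assoc k _ _ v w x fun y hy z hz y' hy' => ?_
  exact insertAt_insertAt_mid y z y' hj (by rwa [hx.length_eq hy']) hji
    (by rwa [hw.length_eq hz])

/-- Covers both associativity laws with disjoint places; only the insertion identity supplied as `h`
differs. -/
theorem diamond_comm {p q r : ℤ} {a b c i j i' j' : ℕ}
    (h : ∀ v w u : Bracketing, v.length = a → w.length = b → u.length = c →
      insertAt v (insertAt w u j) i = insertAt w (insertAt v u i') j')
    {s t u : Seqs k Bracketing} (hs : s ∈ chains k p a)
    (ht : t ∈ chains k q b) (hu : u ∈ chains k r c) :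
    diamond k i s (diamond k j t u) = (p * q).negOnePow • diamond k j' t (diamond k i' s u) := by
  have key := chains_trilinear k (diamondRight k i j)
    ((p * q).negOnePow • (diamondRight k j' i').flip) (fun v w x hv hw hx => ?_) hs ht hu
  · simpa only [LinearMap.smul_apply, LinearMap.flip_apply, diamondRight_apply] using key
  simp only [LinearMap.smul_apply, LinearMap.flip_apply, diamondRight_apply]
  rw [diamond_diamond_right_single k i j hv.ne_nil hw.ne_nil hx.ne_nil,
    diamond_diamond_right_single k j' i' hw.ne_nil hv.ne_nil hx.ne_nil,
    negOnePow_smul k (even_mul_iff hv.1 hw.1)]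
  exact pushforward_shuffle_comm k _ _ v w x fun y hy z hz y' hy' =>
    h y z y' (hv.length_eq hy) (hw.length_eq hz) (hx.length_eq hy')

theorem boundary_diamond {p q : ℤ} {a b : ℕ} (t : ℕ) {s s' : Seqs k Bracketing}
    (hs : s ∈ chains k p a) (hs' : s' ∈ chains k q b) :
    boundary k Bracketing (diamond k t s s') = diamond k t (boundary k Bracketing s) s' +
      p.negOnePow • diamond k t s (boundary k Bracketing s') := by
  induction hs using chains_induction with
  | zero => simp
  | add x y _ _ hx hy =>
    simp only [map_add, LinearMap.add_apply, hx, hy, smul_add]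
    abel
  | smul c x _ hx => simp only [map_smul, LinearMap.smul_apply, hx, smul_add, smul_comm c]
  | single v hv =>
  induction hs' using chains_induction with
  | zero => simp
  | add x y _ _ hx hy =>
    simp only [map_add, hx, hy, smul_add]
    abel
  | smul c x _ hx => simp only [map_smul, hx, smul_add, smul_comm c]
  | single w hw =>
    have hp : Even p ↔ Even (v.length + 1) := by
      rw [← Int.even_coe_nat, Nat.cast_add, hv.1]
      simp [add_assoc]
    -- The ordinary boundary is `dropNil` of the augmented one, so a product with it is a shuffle
    -- with the augmented boundary, also in degree zero.
    have e₁ := diamond_dropNil k t (augBoundary k (Finsupp.single v 1)) (Finsupp.single w 1)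
    have e₂ := diamond_dropNil k t (Finsupp.single v 1) (augBoundary k (Finsupp.single w 1))
    rw [← boundary_eq, dropNil_single k hw.ne_nil] at e₁
    rw [← boundary_eq, dropNil_single k hv.ne_nil] at e₂
    rw [diamond_single k t hv.ne_nil hw.ne_nil, boundary_pushforward, boundary_shuffle, e₁, e₂,
      negOnePow_smul k hp, map_sub, map_smul, pow_succ]
    module

end CompAlgebra

end Associahedron

end

theorem mainTheorem6 (k : Type*) [Field k] [CharZero k] :
    IsDifferentialCompAlgebra (Associahedron.chains k)
      (Associahedron.boundary k Associahedron.Bracketing) (Associahedron.diamond k) := by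
  refine ⟨Associahedron.iSupIndep_chains k, ?_, ?_, ?_, ?_, ?_, ?_, ?_⟩
  · exact fun p a s hs => Associahedron.boundary_mem_chains k hs
  · exact fun p a s _ => Associahedron.boundary_boundary k s
  · exact fun p q a b t ht htb s hs s' hs' => Associahedron.diamond_mem_chains k ht htb hs hs'
  · intro p q r a b c i j hj hjc hi _ s hs t ht u hu hij
    refine Associahedron.diamond_comm k (fun v w x hv hw hx => ?_) hs ht hu
    rw [Associahedron.insertAt_insertAt_left v w x hi (by omega) (by rwa [hx]), hv]
  · intro p q r a b c i j hj hjc _ _ s hs t ht u hu hji hi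
    exact Associahedron.diamond_assoc_mid k hj hjc hji hi hs ht hu
  · intro p q r a b c i j hj _ _ hi s hs t ht u hu hji
    refine Associahedron.diamond_comm k (fun v w x hv hw hx => ?_) hs ht hu
    rw [Associahedron.insertAt_insertAt_right v w x hj (by rwa [hw]) (by rwa [hw, hx]), hw]
  · exact fun p q a b t _ _ s hs s' hs' => Associahedron.boundary_diamond k t hs hs'
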